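/- Let $(\mathcal A,\mathcal E)$ be an exact category in the sense of Quillen: $\mathcal A$ is an additive category and $\mathcal E$ is a class of kernel–cokernel pairs $a'\to a\to a''$ (the admissible short exact sequences, whose first and second maps are called admissible monomorphisms and admissible epimorphisms), closed under isomorphism, containing the split sequences $a'\to a'\oplus a''\to a''$, such that admissible epimorphisms have pullbacks along arbitrary maps and these are again admissible epimorphisms, dually for admissible monomorphisms and pushouts, and such that a map $f$ that has a kernel and for which some composite $f\circ g$ is an admissible epimorphism is itself an admissible epimorphism, and dually. *The Beilinson category.* Let $\Pi=\{(i,j)\in\mathbb Z\times\mathbb Z : i\le j\}$ with the product order. A functor $X\colon\Pi\to\mathcal A$ is admissible if for all $i\le j\le k$ the sequence $X_{i,j}\to X_{i,k}\to X_{j,k}$ is in $\mathcal E$. Call $\varphi\colon\mathbb Z\to\mathbb Z$ bicofinal if it is nondecreasing with $\lim_{n\to\pm\infty}\varphi(n)=\pm\infty$, and put $\tilde\varphi(i,j)=(\varphi(i),\varphi(j))$. The category $\underleftrightarrow{\lim}\,\mathcal A$ is the localization of the category of admissible functors $\Pi\to\mathcal A$ and natural transformations at the class of all canonical maps $X\circ\tilde\varphi_0\to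 X\circ\tilde\varphi_1$ with $X$ admissible and $\varphi_0\le\varphi_1$ bicofinal. *The admissible Kato category.* Let $\mathrm{IP}^a(\mathcal A)$ be the full subcategory of $\mathrm{Ind}(\mathrm{Pro}(\mathcal A))$ of the objects isomorphic to a formal limit $``\varinjlim_{j\in J}"\,``\varprojlim_{i\in I}"\,X_{i,j}$ of a bifunctor $X\colon I^{op}\times J\to\mathcal A$, where $I,J$ are countable filtering preorders, $X_{i',j}\to X_{i,j}$ is an admissible epimorphism for all $i\le i'$ and $j$, and $X_{i,j}\to X_{i,j'}$ is an admissible monomorphism for all $i$ and $j\le j'$. Let $\kappa^a(\mathcal A)$ be the full subcategory of $\mathrm{IP}^a(\mathcal A)$ of the objects that have such a presentation in which moreover, for all $i\le i'$ and $j\le j'$, the square with vertices $X_{i',j},X_{i',j'},X_{i,j},X_{i,j'}$ is cartesian. **Theorem.** The assignment $X\mapsto ``\varinjlim_{j}"\,``\varprojlim_{i\le j}"\,X_{i,j}$ (with $i\to-\infty$, $j\to+\infty$) takes admissible functors $\Pi\to\mathcal A$ to objects of $\kappa^a(\mathcal A)$ and induces a functor $$ i\colon\ \underleftrightarrow{\lim}\,\mathcal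 A\longrightarrow\kappa^a(\mathcal A), $$ and this functor is an equivalence of categories. -/

import Mathlib

open CategoryTheory CategoryTheory.Limits Opposite

universe v u

noncomputable section

namespace LocCompact

/-! ### Exact categories -/

section Exact

variable {A : Type u} [Category.{v} A] [Preadditive A]

/-- `f` is the first map of a member of the class `E` of short sequences. -/
def IsAdmMono (E : ShortComplex A → Prop) {a b : A} (f : a ⟶ b) : Prop :=
  ∃ (c : A) (g : b ⟶ c) (w : f ≫ g = 0), E (ShortComplex.mk f g w)

/-- `g` is the second map of a member of the class `E` of short sequences. -/
def IsAdmEpi (E : ShortComplex A → Prop) {b c : A} (g : b ⟶ c) : Prop :=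
  ∃ (a : A) (f : a ⟶ b) (w : f ≫ g = 0), E (ShortComplex.mk f g w)

variable (A) in
/-- A Quillen exact structure on an additive category `A`: a class `E` of short exact sequences
`0 ⟶ a' ⟶ a ⟶ a'' ⟶ 0`, that is, of kernel-cokernel pairs, satisfying the axioms below.
(Closure of admissible monomorphisms and of admissible epimorphisms under composition, which is
often added to the list, is not asked for.) -/
structure ExactStructure [HasZeroObject A] [HasBinaryBiproducts A] where
  /-- the admissible short exact sequences -/
  E : ShortComplex A → Prop
  isKernel : ∀ S, E S → Nonempty (IsLimit (KernelFork.ofι S.f S.zero))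
  isCokernel : ∀ S, E S → Nonempty (IsColimit (CokernelCofork.ofπ S.g S.zero))
  of_iso : ∀ S T : ShortComplex A, (S ≅ T) → E S → E T
  split : ∀ a b : A, E (ShortComplex.mk (biprod.inl : a ⟶ a ⊞ b) biprod.snd biprod.inl_snd)
  exists_pullback : ∀ {a' a'' b'' : A} (j : a' ⟶ a'') (f : b'' ⟶ a''), IsAdmEpi E j →
    ∃ (b' : A) (j' : b' ⟶ b'') (f' : b' ⟶ a'), IsPullback j' f' f j ∧ IsAdmEpi E j'
  exists_pushout : ∀ {a a' b : A} (i : a ⟶ a') (f : a ⟶ b), IsAdmMono E i →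
    ∃ (b' : A) (i' : b ⟶ b') (f' : a' ⟶ b'), IsPushout f i i' f' ∧ IsAdmMono E i'
  admEpi_of_comp : ∀ {a b c : A} (g : a ⟶ b) (f : b ⟶ c), HasKernel f →
    IsAdmEpi E (g ≫ f) → IsAdmEpi E f
  admMono_of_comp : ∀ {a b c : A} (f : a ⟶ b) (g : b ⟶ c), HasCokernel f →
    IsAdmMono E (f ≫ g) → IsAdmMono E f

end Exact

/-! ### Ind-objects and pro-objects -/

section IndPro

variable {C : Type u} [Category.{v} C]

variable (C) in
/-- The category of pro-objects of `C`. -/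
abbrev Pro : Type (max u (v + 1)) := (Ind Cᵒᵖ)ᵒᵖ

instance hasColimitsOfShape_ind (J : Type) [SmallCategory J] [IsFiltered J] :
    HasColimitsOfShape J (Ind C) :=
  have : HasFilteredColimitsOfSize.{0, 0} (Ind C) :=
    hasFilteredColimitsOfSize_of_univLE.{0, 0, v, v}
  HasFilteredColimitsOfSize.HasColimitsOfShape J

instance hasLimitsOfShape_pro (I : Type) [SmallCategory I] [IsFiltered I] :
    HasLimitsOfShape Iᵒᵖ (Pro C) :=
  hasLimitsOfShape_op_of_hasColimitsOfShape

/-- The ind-object `"colim" X_j` of an ind-system `X : J ⥤ C`. -/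
def indLim (J : Type) [SmallCategory J] [IsFiltered J] : (J ⥤ C) ⥤ Ind C :=
  (Functor.whiskeringRight _ _ _).obj Ind.yoneda ⋙ colim

/-- The pro-object `"lim" X_i` of a pro-system `X : Iᵒᵖ ⥤ C`. -/
def proLim (I : Type) [SmallCategory I] [IsFiltered I] : (Iᵒᵖ ⥤ C) ⥤ Pro C :=
  (Functor.whiskeringRight _ _ _).obj (Ind.yoneda (C := Cᵒᵖ)).rightOp ⋙ lim

/-- The ind/pro-object `"colim"_j "lim"_i X_{i,j}` of a bifunctor `X`, contravariant in `i : I` and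
covariant in `j : J`. -/
def indProLim (I J : Type) [SmallCategory I] [IsFiltered I] [SmallCategory J] [IsFiltered J] :
    (J ⥤ Iᵒᵖ ⥤ C) ⥤ Ind (Pro C) :=
  (Functor.whiskeringRight _ _ _).obj (proLim I) ⋙ indLim J

end IndPro

/-! ### The admissible Kato category -/

section Kato

variable {A : Type u} [Category.{v} A] [Preadditive A] [HasZeroObject A]
  [HasBinaryBiproducts A]

/-- For `i ≤ i'` the map `X_{i',j} ⟶ X_{i,j}` is an admissible epimorphism, and for `j ≤ j'` the map
`X_{i,j} ⟶ X_{i,j'}` is an admissible monomorphism. -/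
structure IsAdmBifunctor (𝓔 : ExactStructure A) {I J : Type} [SmallCategory I] [SmallCategory J]
    (X : J ⥤ Iᵒᵖ ⥤ A) : Prop where
  admEpi : ∀ (j : J) {i i' : I} (f : i ⟶ i'), IsAdmEpi 𝓔.E ((X.obj j).map f.op)
  admMono : ∀ (i : I) {j j' : J} (g : j ⟶ j'), IsAdmMono 𝓔.E ((X.map g).app (op i))

/-- All the squares with vertices `X_{i',j}`, `X_{i',j'}`, `X_{i,j}`, `X_{i,j'}` are cartesian. -/
def HasCartesianSquares {I J : Type} [SmallCategory I] [SmallCategory J]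
    (X : J ⥤ Iᵒᵖ ⥤ A) : Prop :=
  ∀ {i i' : I} (f : i ⟶ i') {j j' : J} (g : j ⟶ j'),
    IsPullback ((X.map g).app (op i')) ((X.obj j).map f.op) ((X.obj j').map f.op)
      ((X.map g).app (op i))

/-- The strictly admissible straightified ind/pro-objects of countable type: the formal limits of
admissible bifunctors indexed by countable filtering preorders. -/
def isIPa (𝓔 : ExactStructure A) : ObjectProperty (Ind (Pro A)) := fun P =>
  ∃ (I J : Type) (_ : Preorder I) (_ : Preorder J) (_ : Countable I) (_ : Countable J)
    (_ : IsFiltered I) (_ : IsFiltered J) (X : J ⥤ Iᵒᵖ ⥤ A),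
    IsAdmBifunctor 𝓔 X ∧ Nonempty (P ≅ (indProLim I J).obj X)

/-- Those formal limits of admissible bifunctors whose squares are cartesian. -/
def isKato (𝓔 : ExactStructure A) : ObjectProperty (Ind (Pro A)) := fun P =>
  ∃ (I J : Type) (_ : Preorder I) (_ : Preorder J) (_ : Countable I) (_ : Countable J)
    (_ : IsFiltered I) (_ : IsFiltered J) (X : J ⥤ Iᵒᵖ ⥤ A),
    IsAdmBifunctor 𝓔 X ∧ HasCartesianSquares X ∧ Nonempty (P ≅ (indProLim I J).obj X)

theorem isKato_le_isIPa (𝓔 : ExactStructure A) : isKato 𝓔 ≤ isIPa 𝓔 := by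
  rintro P ⟨I, J, _, _, hI, hJ, _, _, X, hX, _, e⟩
  exact ⟨I, J, _, _, hI, hJ, _, _, X, hX, e⟩

/-- The category `IPᵃ(A)`. -/
abbrev IPa (𝓔 : ExactStructure A) := (isIPa 𝓔).FullSubcategory

/-- The admissible Kato category `κᵃ(A)`, a full subcategory of `IPᵃ(A)`. -/
abbrev Kato (𝓔 : ExactStructure A) := ((isKato 𝓔).inverseImage (isIPa 𝓔).ι).FullSubcategory

end Kato

/-! ### The Beilinson category -/

section Beilinson

/-- The preorder of the pairs of integers `(i, j)` with `i ≤ j`. -/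
abbrev Wedge : Type := {p : ℤ × ℤ // p.1 ≤ p.2}

/-- The pair `(i, j)`. -/
abbrev Wedge.mk (i j : ℤ) (h : i ≤ j) : Wedge := ⟨(i, j), h⟩

/-- The arrow `(i, j) ⟶ (i', j')` of `Wedge`. -/
abbrev Wedge.hom {i j i' j' : ℤ} (h : i ≤ j) (h' : i' ≤ j') (hi : i ≤ i') (hj : j ≤ j') :
    Wedge.mk i j h ⟶ Wedge.mk i' j' h' :=
  homOfLE (show Wedge.mk i j h ≤ Wedge.mk i' j' h' from ⟨hi, hj⟩)

/-- A bicofinal map: nondecreasing, with limit `±∞` at `±∞`. -/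
structure Bicofinal where
  /-- the underlying map -/
  toFun : ℤ → ℤ
  mono : Monotone toFun
  tendsto_atTop : Filter.Tendsto toFun Filter.atTop Filter.atTop
  tendsto_atBot : Filter.Tendsto toFun Filter.atBot Filter.atBot

/-- The endofunctor `(i, j) ↦ (φ i, φ j)` of `Wedge`. -/
def Bicofinal.tilde (φ : Bicofinal) : Wedge ⥤ Wedge :=
  Monotone.functor (f := fun p : Wedge => Wedge.mk (φ.toFun p.1.1) (φ.toFun p.1.2) (φ.mono p.2))
    (fun _ _ h => ⟨φ.mono h.1, φ.mono h.2⟩)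

/-- The transformation between the endofunctors of `Wedge` attached to `φ₀ ≤ φ₁`. -/
def Bicofinal.tildeHom {φ₀ φ₁ : Bicofinal} (h : ∀ n, φ₀.toFun n ≤ φ₁.toFun n) :
    φ₀.tilde ⟶ φ₁.tilde where
  app p := Wedge.hom (φ₀.mono p.2) (φ₁.mono p.2) (h p.1.1) (h p.1.2)
  naturality _ _ _ := Subsingleton.elim _ _

variable {A : Type u} [Category.{v} A] [Preadditive A] [HasZeroObject A]
  [HasBinaryBiproducts A]

/-- `X : Wedge ⥤ A` is admissible if `X_{i,j} ⟶ X_{i,k} ⟶ X_{j,k}` is an admissible short exact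
sequence whenever `i ≤ j ≤ k`. -/
def isAdm (𝓔 : ExactStructure A) : ObjectProperty (Wedge ⥤ A) := fun X =>
  ∀ (i j k : ℤ) (hij : i ≤ j) (hjk : j ≤ k),
    ∃ w : X.map (Wedge.hom hij (hij.trans hjk) le_rfl hjk) ≫
        X.map (Wedge.hom (hij.trans hjk) hjk hij le_rfl) = 0,
      𝓔.E (ShortComplex.mk _ _ w)

/-- The category of admissible functors `Wedge ⥤ A`. -/
abbrev BiFunA (𝓔 : ExactStructure A) := (isAdm 𝓔).FullSubcategory

theorem isAdm_tilde (𝓔 : ExactStructure A) {X : Wedge ⥤ A} (hX : isAdm 𝓔 X) (φ : Bicofinal) :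
    isAdm 𝓔 (φ.tilde ⋙ X) :=
  fun i j k hij hjk => hX (φ.toFun i) (φ.toFun j) (φ.toFun k) (φ.mono hij) (φ.mono hjk)

/-- The admissible functor `X ∘ φ̃`. -/
def BiFunA.precomp {𝓔 : ExactStructure A} (X : BiFunA 𝓔) (φ : Bicofinal) : BiFunA 𝓔 :=
  ⟨φ.tilde ⋙ X.obj, isAdm_tilde 𝓔 X.property φ⟩

/-- The canonical map `X ∘ φ̃₀ ⟶ X ∘ φ̃₁` for `φ₀ ≤ φ₁`. -/
def BiFunA.precompHom {𝓔 : ExactStructure A} (X : BiFunA 𝓔) {φ₀ φ₁ : Bicofinal}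
    (h : ∀ n, φ₀.toFun n ≤ φ₁.toFun n) : X.precomp φ₀ ⟶ X.precomp φ₁ :=
  ObjectProperty.homMk (Functor.whiskerRight (Bicofinal.tildeHom h) X.obj)

/-- The class `U_a` of all the maps `X ∘ φ̃₀ ⟶ X ∘ φ̃₁`, for `X` admissible and `φ₀ ≤ φ₁` bicofinal. -/
inductive Ua (𝓔 : ExactStructure A) : MorphismProperty (BiFunA 𝓔)
  | mk (X : BiFunA 𝓔) (φ₀ φ₁ : Bicofinal) (h : ∀ n, φ₀.toFun n ≤ φ₁.toFun n) :
      Ua 𝓔 (X.precompHom h)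

/-- The Beilinson category of `A`: the localization of the category of admissible functors at
`U_a`. -/
abbrev Beilinson (𝓔 : ExactStructure A) := (Ua 𝓔).Localization

end Beilinson

/-! ### The functor from the Beilinson category to the admissible Kato category -/

section Comparison

/-- The map `(j, i) ↦ (min i j, j)`, which is the identity on the pairs with `i ≤ j`. The index `i`
runs over the integers with the opposite order, as the index of a pro-system. -/
def retract : ℤ × (ℤᵒᵈ)ᵒᵖ ⥤ Wedge where
  obj p := Wedge.mk (min (OrderDual.ofDual p.2.unop) p.1) p.1 (min_le_right _ _)
  map {p q} f := Wedge.hom _ _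
    (min_le_min (show OrderDual.ofDual p.2.unop ≤ OrderDual.ofDual q.2.unop from f.2.unop.le)
      f.1.le) f.1.le
  map_id _ := Subsingleton.elim _ _
  map_comp _ _ := Subsingleton.elim _ _

variable {A : Type u} [Category.{v} A]

/-- The extension of `X : Wedge ⥤ A` to a bifunctor: for each `j` the pro-system `X_{i,j}`, `i ≤ j`,
is continued by `X_{j,j}` for `i > j`; this does not change its formal limit. -/
def extend : (Wedge ⥤ A) ⥤ (ℤ ⥤ (ℤᵒᵈ)ᵒᵖ ⥤ A) :=
  (Functor.whiskeringLeft _ _ _).obj retract ⋙ Functor.curry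

/-- The functor `X ↦ "colim"_j "lim"_{i ≤ j} X_{i,j}`. -/
def wedgeLim : (Wedge ⥤ A) ⥤ Ind (Pro A) :=
  extend ⋙ indProLim ℤᵒᵈ ℤ

/-- Restriction of a bifunctor along functors of the index categories. -/
abbrev restrict {I J I' J' : Type} [SmallCategory I] [SmallCategory J] [SmallCategory I']
    [SmallCategory J'] (G : I' ⥤ I) (F : J' ⥤ J) (X : J ⥤ Iᵒᵖ ⥤ A) : J' ⥤ I'ᵒᵖ ⥤ A :=
  F ⋙ X ⋙ (Functor.whiskeringLeft _ _ _).obj G.op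

/-- Formal limits do not change under restriction along a cofinal functor. -/
def proRes {I I' : Type} [SmallCategory I] [SmallCategory I'] [IsFiltered I]
    [IsFiltered I'] (G : I' ⥤ I) [G.Final] :
    proLim I ≅ (Functor.whiskeringLeft _ _ A).obj G.op ⋙ proLim I' :=
  Functor.isoWhiskerLeft ((Functor.whiskeringRight _ _ _).obj (Ind.yoneda (C := Aᵒᵖ)).rightOp)
    (Functor.Initial.limIso G.op).symm

/-- The projections of a formal limit. -/
def proπ {I : Type} [SmallCategory I] [IsFiltered I] (Y : Iᵒᵖ ⥤ A) (i : I) :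
    (proLim I).obj Y ⟶ (Ind.yoneda (C := Aᵒᵖ)).rightOp.obj (Y.obj (op i)) :=
  limit.π (Y ⋙ (Ind.yoneda (C := Aᵒᵖ)).rightOp) (op i)

theorem proLim_hom_ext {I : Type} [SmallCategory I] [IsFiltered I] {Y : Iᵒᵖ ⥤ A} {P : Pro A}
    {f g : P ⟶ (proLim I).obj Y} (h : ∀ i, f ≫ proπ Y i = g ≫ proπ Y i) : f = g :=
  limit.hom_ext fun i => h i.unop

theorem proLim_map_π {I : Type} [SmallCategory I] [IsFiltered I] {Y Z : Iᵒᵖ ⥤ A} (f : Y ⟶ Z)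
    (i : I) : (proLim I).map f ≫ proπ Z i =
      proπ Y i ≫ (Ind.yoneda (C := Aᵒᵖ)).rightOp.map (f.app (op i)) :=
  limMap_π _ _

theorem proπ_w {I : Type} [SmallCategory I] [IsFiltered I] (Y : Iᵒᵖ ⥤ A) {i i' : I} (f : i ⟶ i') :
    proπ Y i' ≫ (Ind.yoneda (C := Aᵒᵖ)).rightOp.map (Y.map f.op) = proπ Y i :=
  limit.w (Y ⋙ (Ind.yoneda (C := Aᵒᵖ)).rightOp) f.op

theorem proRes_π {I I' : Type} [SmallCategory I] [SmallCategory I'] [IsFiltered I]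
    [IsFiltered I'] (G : I' ⥤ I) [G.Final] (Y : Iᵒᵖ ⥤ A) (i : I') :
    (proRes G).hom.app Y ≫ proπ (G.op ⋙ Y) i = proπ Y (G.obj i) :=
  limit.pre_π (Y ⋙ (Ind.yoneda (C := Aᵒᵖ)).rightOp) G.op (op i)

theorem indProLim_restrict {I J I' J' : Type} [SmallCategory I] [SmallCategory J]
    [SmallCategory I'] [SmallCategory J'] [IsFiltered I] [IsFiltered I'] [IsFiltered J]
    [IsFiltered J'] (G : I' ⥤ I) [G.Final] (F : J' ⥤ J) [F.Final] (X : J ⥤ Iᵒᵖ ⥤ A) :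
    Nonempty ((indProLim I J).obj X ≅ (indProLim I' J').obj (restrict G F X)) :=
  ⟨(Functor.Final.colimitIso F ((X ⋙ proLim I) ⋙ Ind.yoneda)).symm ≪≫
    (indLim J').mapIso (Functor.isoWhiskerLeft (F ⋙ X) (proRes G))⟩

/-- `φ` as a functor. -/
abbrev Bicofinal.functor (φ : Bicofinal) : ℤ ⥤ ℤ := φ.mono.functor

/-- `φ` as a functor for the opposite order. -/
abbrev Bicofinal.dualFunctor (φ : Bicofinal) : ℤᵒᵈ ⥤ ℤᵒᵈ := φ.mono.dual.functor

instance (φ : Bicofinal) : φ.functor.Final := by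
  rw [Monotone.final_functor_iff]
  intro n
  exact (φ.tendsto_atTop.eventually_ge_atTop n).exists

instance (φ : Bicofinal) : φ.dualFunctor.Final := by
  rw [Monotone.final_functor_iff]
  intro n
  exact (φ.tendsto_atBot.eventually_le_atBot (OrderDual.ofDual n)).exists

theorem wedge_comp (X : Wedge ⥤ A) {p q q' r : Wedge} (f : p ⟶ q) (g : q ⟶ r) (f' : p ⟶ q')
    (g' : q' ⟶ r) : X.map f ≫ X.map g = X.map f' ≫ X.map g' := by
  rw [← X.map_comp, ← X.map_comp]
  rfl

theorem wedge_comp₃ (X : Wedge ⥤ A) {p q q' r s : Wedge} (f : p ⟶ q) (g : q ⟶ r) (h : r ⟶ s)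
    (f' : p ⟶ q') (g' : q' ⟶ s) : (X.map f ≫ X.map g) ≫ X.map h = X.map f' ≫ X.map g' := by
  rw [← X.map_comp, ← X.map_comp, ← X.map_comp]
  rfl

/-- The extension of `X ∘ φ̃` is the restriction of the extension of `X`. -/
def extendTilde (φ : Bicofinal) (X : Wedge ⥤ A) :
    restrict φ.dualFunctor φ.functor (extend.obj X) ≅ extend.obj (φ.tilde ⋙ X) :=
  NatIso.ofComponents (fun j => NatIso.ofComponents (fun i => X.mapIso
      (eqToIso (Subtype.ext (Prod.ext (φ.mono.map_min).symm rfl))))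
      (fun _ => by
        change X.map _ ≫ X.map _ = X.map _ ≫ X.map _
        rw [← X.map_comp, ← X.map_comp]
        rfl))
    (fun _ => by
      ext i
      change X.map _ ≫ X.map _ = X.map _ ≫ X.map _
      rw [← X.map_comp, ← X.map_comp]
      rfl)

/-- The ind-system of formal limits of `X ∘ φ̃`, computed from that of `X`. -/
def tildeSystem (φ : Bicofinal) (X : Wedge ⥤ A) :
    φ.functor ⋙ extend.obj X ⋙ proLim ℤᵒᵈ ≅ extend.obj (φ.tilde ⋙ X) ⋙ proLim ℤᵒᵈ :=
  Functor.isoWhiskerLeft (φ.functor ⋙ extend.obj X) (proRes φ.dualFunctor) ≪≫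
    Functor.isoWhiskerRight (extendTilde φ X) (proLim ℤᵒᵈ)

/-- The transformation between the functors attached to `φ₀ ≤ φ₁`. -/
def Bicofinal.functorHom {φ₀ φ₁ : Bicofinal} (h : ∀ n, φ₀.toFun n ≤ φ₁.toFun n) :
    φ₀.functor ⟶ φ₁.functor where
  app n := homOfLE (h n)
  naturality _ _ _ := Subsingleton.elim _ _

theorem tildeSystem_π (φ : Bicofinal) (X : Wedge ⥤ A) (j : ℤ) (i : ℤᵒᵈ) :
    (tildeSystem φ X).hom.app j ≫ proπ ((extend.obj (φ.tilde ⋙ X)).obj j) i =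
      proπ ((extend.obj X).obj (φ.toFun j)) (φ.dualFunctor.obj i) ≫
        (Ind.yoneda (C := Aᵒᵖ)).rightOp.map (((extendTilde φ X).hom.app j).app (op i)) := by
  have e₁ := proLim_map_π ((extendTilde φ X).hom.app j) i
  have e₂ := proRes_π φ.dualFunctor ((extend.obj X).obj (φ.toFun j)) i
  exact (Category.assoc _ _ _).trans ((congrArg (fun t => (proRes φ.dualFunctor).hom.app
    ((extend.obj X).obj (φ.toFun j)) ≫ t) e₁).trans ((Category.assoc _ _ _).symm.trans
      (congrArg (fun t => t ≫ (Ind.yoneda (C := Aᵒᵖ)).rightOp.map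
        (((extendTilde φ X).hom.app j).app (op i))) e₂)))

theorem tildeSystem_naturality {φ₀ φ₁ : Bicofinal} (h : ∀ n, φ₀.toFun n ≤ φ₁.toFun n)
    (X : Wedge ⥤ A) :
    Functor.whiskerRight (Bicofinal.functorHom h) (extend.obj X ⋙ proLim ℤᵒᵈ) ≫
        (tildeSystem φ₁ X).hom =
      (tildeSystem φ₀ X).hom ≫ Functor.whiskerRight
        (extend.map (Functor.whiskerRight (Bicofinal.tildeHom h) X)) (proLim ℤᵒᵈ) := by
  ext j : 2
  apply proLim_hom_ext
  intro i
  have e₁ : (proLim ℤᵒᵈ).map ((extend.obj X).map (homOfLE (h j))) ≫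
      proπ ((extend.obj X).obj (φ₁.toFun j)) (φ₁.dualFunctor.obj i) =
      proπ ((extend.obj X).obj (φ₀.toFun j)) (φ₀.dualFunctor.obj i) ≫
        (Ind.yoneda (C := Aᵒᵖ)).rightOp.map (((extend.obj X).obj (φ₀.toFun j)).map
          (homOfLE (show φ₁.dualFunctor.obj i ≤ φ₀.dualFunctor.obj i from h _)).op ≫
        ((extend.obj X).map (homOfLE (h j))).app (op (φ₁.dualFunctor.obj i))) := by
    rw [proLim_map_π, Functor.map_comp, ← Category.assoc, proπ_w]
  have e₂ := tildeSystem_π φ₁ X j i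
  have e₃ := tildeSystem_π φ₀ X j i
  have e₄ := proLim_map_π ((extend.map (Functor.whiskerRight (Bicofinal.tildeHom h) X)).app j) i
  change ((proLim ℤᵒᵈ).map ((extend.obj X).map (homOfLE (h j))) ≫
    (tildeSystem φ₁ X).hom.app j) ≫ _ = ((tildeSystem φ₀ X).hom.app j ≫ (proLim ℤᵒᵈ).map
      ((extend.map (Functor.whiskerRight (Bicofinal.tildeHom h) X)).app j)) ≫ _
  have e₅ : (((extend.obj X).obj (φ₀.toFun j)).map
          (homOfLE (show φ₁.dualFunctor.obj i ≤ φ₀.dualFunctor.obj i from h _)).op ≫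
        ((extend.obj X).map (homOfLE (h j))).app (op (φ₁.dualFunctor.obj i))) ≫
        ((extendTilde φ₁ X).hom.app j).app (op i) =
      ((extendTilde φ₀ X).hom.app j).app (op i) ≫
        ((extend.map (Functor.whiskerRight (Bicofinal.tildeHom h) X)).app j).app (op i) :=
    wedge_comp₃ X _ _ _ _ _
  have e₆ := (Functor.map_comp _ _ _).symm.trans
    ((congrArg (Ind.yoneda (C := Aᵒᵖ)).rightOp.map e₅).trans (Functor.map_comp _ _ _))
  refine (Category.assoc _ _ _).trans ((congrArg _ e₂).trans ?_)
  refine Eq.trans ?_ ((Category.assoc _ _ _).trans (congrArg _ e₄)).symm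
  refine (Category.assoc _ _ _).symm.trans ((congrArg (fun t => t ≫ _) e₁).trans ?_)
  refine Eq.trans ?_ ((Category.assoc _ _ _).symm.trans (congrArg (fun t => t ≫ _) e₃)).symm
  exact (Category.assoc _ _ _).trans ((congrArg _ e₆).trans (Category.assoc _ _ _).symm)

theorem wedgeLim_isIso {φ₀ φ₁ : Bicofinal} (h : ∀ n, φ₀.toFun n ≤ φ₁.toFun n) (X : Wedge ⥤ A) :
    IsIso (wedgeLim.map (Functor.whiskerRight (Bicofinal.tildeHom h) X)) := by
  set P := extend.obj X ⋙ proLim ℤᵒᵈ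
  let m := Functor.whiskerRight (Bicofinal.functorHom h) P
  have tri : (indLim ℤ).map m ≫ colimit.pre (P ⋙ Ind.yoneda) φ₁.functor =
      colimit.pre (P ⋙ Ind.yoneda) φ₀.functor := by
    apply colimit.hom_ext
    intro j
    have e₁ : colimit.ι (φ₀.functor ⋙ P ⋙ Ind.yoneda) j ≫ (indLim ℤ).map m =
        Ind.yoneda.map (m.app j) ≫ colimit.ι (φ₁.functor ⋙ P ⋙ Ind.yoneda) j :=
      ι_colimMap (Functor.whiskerRight m Ind.yoneda) j
    have e₂ := colimit.ι_pre (P ⋙ Ind.yoneda) φ₁.functor j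
    have e₃ := colimit.ι_pre (P ⋙ Ind.yoneda) φ₀.functor j
    have e₄ := colimit.w (P ⋙ Ind.yoneda) (homOfLE (h j))
    refine (Category.assoc _ _ _).symm.trans ((congrArg (fun t => t ≫ _) e₁).trans ?_)
    exact (Category.assoc _ _ _).trans ((congrArg _ e₂).trans (e₄.trans e₃.symm))
  have h₀ : IsIso (colimit.pre (P ⋙ Ind.yoneda) φ₀.functor) :=
    Functor.Final.colimit_pre_isIso φ₀.functor
  have h₁ : IsIso (colimit.pre (P ⋙ Ind.yoneda) φ₁.functor) :=
    Functor.Final.colimit_pre_isIso φ₁.functor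
  have hm : IsIso ((indLim ℤ).map m) := by
    have : IsIso ((indLim ℤ).map m ≫ colimit.pre (P ⋙ Ind.yoneda) φ₁.functor) := by
      rw [tri]; exact h₀
    exact @IsIso.of_isIso_comp_right _ _ _ _ _ _ (colimit.pre (P ⋙ Ind.yoneda) φ₁.functor) h₁ this
  have sq := congrArg (indLim ℤ).map (tildeSystem_naturality h X)
  rw [Functor.map_comp, Functor.map_comp] at sq
  have : IsIso ((indLim ℤ).map (tildeSystem φ₀ X).hom ≫ (indLim ℤ).map (Functor.whiskerRight
        (extend.map (Functor.whiskerRight (Bicofinal.tildeHom h) X)) (proLim ℤᵒᵈ))) := by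
    rw [← sq]; exact IsIso.comp_isIso' hm inferInstance
  exact @IsIso.of_isIso_comp_left _ _ _ _ _ ((indLim ℤ).map (tildeSystem φ₀ X).hom) _
    inferInstance this

variable [Preadditive A] [HasZeroObject A] [HasBinaryBiproducts A]

theorem isAdm.admEpi {𝓔 : ExactStructure A} {X : Wedge ⥤ A} (hX : isAdm 𝓔 X)
    {i i' j : ℤ} (hi : i ≤ i') (hij : i' ≤ j) :
    IsAdmEpi 𝓔.E (X.map (Wedge.hom (hi.trans hij) hij hi le_rfl)) :=
  let ⟨w, hw⟩ := hX i i' j hi hij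
  ⟨_, _, w, hw⟩

theorem isAdm.admMono {𝓔 : ExactStructure A} {X : Wedge ⥤ A} (hX : isAdm 𝓔 X)
    {i j j' : ℤ} (hij : i ≤ j) (hj : j ≤ j') :
    IsAdmMono 𝓔.E (X.map (Wedge.hom hij (hij.trans hj) le_rfl hj)) :=
  let ⟨w, hw⟩ := hX i j j' hij hj
  ⟨_, _, w, hw⟩

theorem isAdm.isPullback {𝓔 : ExactStructure A} {X : Wedge ⥤ A} (hX : isAdm 𝓔 X)
    {i i' j j' : ℤ} (hi : i ≤ i') (hij : i' ≤ j) (hj : j ≤ j') :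
    IsPullback (X.map (Wedge.hom (hi.trans hij) (hi.trans (hij.trans hj)) le_rfl hj))
      (X.map (Wedge.hom (hi.trans hij) hij hi le_rfl))
      (X.map (Wedge.hom (hi.trans (hij.trans hj)) (hij.trans hj) hi le_rfl))
      (X.map (Wedge.hom hij (hij.trans hj) le_rfl hj)) := by
  have comm := wedge_comp X (Wedge.hom (hi.trans hij) (hi.trans (hij.trans hj)) le_rfl hj)
    (Wedge.hom (hi.trans (hij.trans hj)) (hij.trans hj) hi le_rfl)
    (Wedge.hom (hi.trans hij) hij hi le_rfl) (Wedge.hom hij (hij.trans hj) le_rfl hj)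
  obtain ⟨w₁, hw₁⟩ := hX i j j' (hi.trans hij) hj
  obtain ⟨w₂, hw₂⟩ := hX i' j j' hij hj
  obtain ⟨k₁⟩ := 𝓔.isKernel _ hw₁
  obtain ⟨k₂⟩ := 𝓔.isKernel _ hw₂
  have m₁ := mono_of_isLimit_fork k₁
  have m₂ := mono_of_isLimit_fork k₂
  dsimp at m₁ m₂
  have tri : X.map (Wedge.hom (hi.trans (hij.trans hj)) hj (hi.trans hij) le_rfl) =
      X.map (Wedge.hom (hi.trans (hij.trans hj)) (hij.trans hj) hi le_rfl) ≫
        X.map (Wedge.hom (hij.trans hj) hj hij le_rfl) := (X.map_comp _ _)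
  refine ⟨⟨comm⟩, ⟨PullbackCone.IsLimit.mk comm
    (fun c => k₁.lift (KernelFork.ofι c.fst ?_)) (fun c => ?_) (fun c => ?_) (fun c m h _ => ?_)⟩⟩
  · change c.fst ≫ X.map _ = 0
    rw [tri, ← Category.assoc, c.condition, Category.assoc]
    exact (congrArg (fun t => c.snd ≫ t) w₂).trans comp_zero
  · exact k₁.fac (KernelFork.ofι c.fst _) WalkingParallelPair.zero
  · rw [← cancel_mono (X.map (Wedge.hom hij (hij.trans hj) le_rfl hj)), Category.assoc, ← comm,
      ← Category.assoc]
    exact (congrArg (fun t => t ≫ _)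
      (k₁.fac (KernelFork.ofι c.fst _) WalkingParallelPair.zero)).trans c.condition
  · rw [← cancel_mono (X.map (Wedge.hom (hi.trans hij) (hi.trans (hij.trans hj)) le_rfl hj)), h]
    exact (k₁.fac (KernelFork.ofι c.fst _) WalkingParallelPair.zero).symm

theorem isAdm.admMono' {𝓔 : ExactStructure A} {X : Wedge ⥤ A} (hX : isAdm 𝓔 X)
    {i i₁ j j' : ℤ} (e : i = i₁) (hij : i ≤ j) (hj : j ≤ j') :
    IsAdmMono 𝓔.E (X.map (Wedge.hom hij (e.ge.trans (hij.trans hj)) e.le hj)) := by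
  subst e
  exact hX.admMono hij hj

theorem isAdm.isPullback' {𝓔 : ExactStructure A} {X : Wedge ⥤ A} (hX : isAdm 𝓔 X)
    {i i₁ i' i₁' j j' : ℤ} (e : i = i₁) (e' : i' = i₁') (hi : i ≤ i') (hij : i' ≤ j)
    (hj : j ≤ j') :
    IsPullback
      (X.map (Wedge.hom (hi.trans hij) (e.ge.trans (hi.trans (hij.trans hj))) e.le hj))
      (X.map (Wedge.hom (hi.trans hij) hij hi le_rfl))
      (X.map (Wedge.hom (e.ge.trans (hi.trans (hij.trans hj))) (e'.ge.trans (hij.trans hj))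
        (e.ge.trans (hi.trans e'.le)) le_rfl))
      (X.map (Wedge.hom hij (e'.ge.trans (hij.trans hj)) e'.le hj)) := by
  subst e e'
  exact hX.isPullback hi hij hj

/-- The formal limit of an admissible functor `Wedge ⥤ A` is in the admissible Kato category: it
may be computed over the pairs `(i, j)` with `i ≤ 0 ≤ j`. -/
theorem isKato_wedgeLim {𝓔 : ExactStructure A} {X : Wedge ⥤ A} (hX : isAdm 𝓔 X) :
    isKato 𝓔 (wedgeLim.obj X) := by
  have hF : Monotone (fun n : ℕ => (n : ℤ)) := fun a b h => Int.ofNat_le.2 h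
  have hG : Monotone (fun n : ℕ => OrderDual.toDual (-(n : ℤ))) := fun a b h =>
    show -(b : ℤ) ≤ -(a : ℤ) from neg_le_neg (Int.ofNat_le.2 h)
  have : hF.functor.Final := by
    rw [Monotone.final_functor_iff]
    exact fun n => ⟨n.toNat, Int.self_le_toNat n⟩
  have : hG.functor.Final := by
    rw [Monotone.final_functor_iff]
    exact fun n => ⟨(-(OrderDual.ofDual n)).toNat,
      show -((-(OrderDual.ofDual n)).toNat : ℤ) ≤ OrderDual.ofDual n from
        neg_le.1 (Int.self_le_toNat _)⟩
  refine ⟨ℕ, ℕ, inferInstance, inferInstance, inferInstance, inferInstance, inferInstance,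
    inferInstance, restrict hG.functor hF.functor (extend.obj X), ⟨?_, ?_⟩, ?_,
    indProLim_restrict hG.functor hF.functor (extend.obj X)⟩
  · intro j i i' f
    have hf : i ≤ i' := f.le
    exact hX.admEpi (i := min (-(i' : ℤ)) j) (i' := min (-(i : ℤ)) j) (j := j) (by omega)
      (by omega)
  · intro i j j' g
    have hg : j ≤ j' := g.le
    exact hX.admMono' (i := min (-(i : ℤ)) j) (i₁ := min (-(i : ℤ)) j') (j := j) (j' := j')
      (by omega) (by omega) (by omega)
  · intro i i' f j j' g
    have hf : i ≤ i' := f.le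
    have hg : j ≤ j' := g.le
    exact hX.isPullback' (i := min (-(i' : ℤ)) j) (i₁ := min (-(i' : ℤ)) j')
      (i' := min (-(i : ℤ)) j) (i₁' := min (-(i : ℤ)) j') (j := j) (j' := j')
      (by omega) (by omega) (by omega) (by omega) (by omega)

/-- The functor from admissible functors `Wedge ⥤ A` to the admissible Kato category given by
`X ↦ "colim"_j "lim"_{i ≤ j} X_{i,j}`. -/
def biFunToKato (𝓔 : ExactStructure A) : BiFunA 𝓔 ⥤ Kato 𝓔 :=
  ObjectProperty.lift _
    (ObjectProperty.lift _ ((isAdm 𝓔).ι ⋙ wedgeLim)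
      (fun X => isKato_le_isIPa 𝓔 _ (isKato_wedgeLim X.property)))
    (fun X => isKato_wedgeLim X.property)

theorem biFunToKato_inverts (𝓔 : ExactStructure A) : (Ua 𝓔).IsInvertedBy (biFunToKato 𝓔) := by
  rintro _ _ _ ⟨X, φ₀, φ₁, h⟩
  have : IsIso ((isIPa 𝓔).ι.map (((isKato 𝓔).inverseImage (isIPa 𝓔).ι).ι.map
    ((biFunToKato 𝓔).map (X.precompHom h)))) := wedgeLim_isIso h X.obj
  have := isIso_of_reflects_iso (((isKato 𝓔).inverseImage (isIPa 𝓔).ι).ι.map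
    ((biFunToKato 𝓔).map (X.precompHom h))) (isIPa 𝓔).ι
  exact isIso_of_reflects_iso _ ((isKato 𝓔).inverseImage (isIPa 𝓔).ι).ι

/-- The embedding of the Beilinson category in the admissible Kato category: the functor induced on
the localization by `X ↦ "colim"_j "lim"_{i ≤ j} X_{i,j}`. -/
def embedding (𝓔 : ExactStructure A) : Beilinson 𝓔 ⥤ Kato 𝓔 :=
  Localization.Construction.lift (biFunToKato 𝓔) (biFunToKato_inverts 𝓔)

end Comparison

end LocCompact

end

/-! Write `X_n` for the pro-object "lim"_{i ≤ n} `X_{i,n}`; an admissible `X` behaves like the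
filtration `X_n` of its formal limit, with `X_{i,j}` in the role of `X_j / X_i`.

Full faithfulness. Representables are compact, so a map from `X_n` to the formal limit of `Y` lands
in some `Y_l`, and a map from `X_n` to an object of `A` is represented on some `X_{i,n}`. Transition
maps are epi in the pro-direction and mono in the ind-direction, so these stages cancel, and
`wedgeLim` is faithful already before localizing (`isAdm.wedgeLim_map_injective`). Given a map `f`
of formal limits, let `φ n` be the least `l ≥ n` such that `f` carries `X_n` into `Y_l`. This is
bicofinal, the limit at `-∞` coming from `isAdm.exists_mapsInto_of_le`, and passing to quotients
gives `X ⟶ Y ∘ φ̃` representing `f` (`isAdm.exists_fraction`). In the localization every map is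
likewise a fraction with denominator `Y ⟶ Y ∘ φ̃` (`isFraction`). Two fractions have a common
denominator, and their numerators are then compared by the faithful `wedgeLim`.

Essential surjectivity. Cofinal sequences reduce to a bifunctor on `ℕᵒᵖ × ℕ`, which is placed on the
quadrant `i < 0 ≤ j` of `Wedge`. The remaining values are forced: kernels of pro-transition maps for
`i ≤ j < 0`, cokernels of ind-transition maps for `0 ≤ i ≤ j`. The functors `gridKer` and `wedgeExt`
produce them by uniform formulas. Cartesian squares give exactness (`IsGrid.isAdm_wedgeExt`), and
the quadrant is cofinal, so it determines the formal limit. -/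

noncomputable section

namespace LocCompact

/-! ### Maps in ind- and pro-categories: compactness of representables. -/

section IndProHoms

variable {C : Type u} [Category.{v} C]

/-- Maps out of a representable ind-object are elements of the underlying presheaf. -/
def coyonedaIndYoneda (P : C) :
    coyoneda.obj (op (Ind.yoneda.obj P)) ≅
      Ind.inclusion C ⋙ (CategoryTheory.evaluation _ _).obj (op P) :=
  NatIso.ofComponents (fun Y => Equiv.toIso
    (Ind.inclusion.fullyFaithful.homEquiv.trans
      (((Ind.yonedaCompInclusion.app P).homCongr (Iso.refl _)).trans yonedaEquiv)))
    (fun {Y Z} f => by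
      ext g
      simp [yonedaEquiv, Functor.FullyFaithful.homEquiv])

/-- Compactness of `P`: `Ind.inclusion` preserves filtered colimits, and evaluation of presheaves at
`P` preserves all colimits. The known instance concerns size `v`, while `J` lives in `Type`. -/
theorem preservesColimitsOfShape_coyonedaIndYoneda (P : C) (J : Type) [SmallCategory J]
    [IsFiltered J] :
    PreservesColimitsOfShape J (coyoneda.obj (op (Ind.yoneda.obj P))) := by
  have h₁ : PreservesFilteredColimitsOfSize.{v, v} (Ind.inclusion C) := ⟨fun J _ _ => inferInstance⟩
  have h₂ : PreservesFilteredColimitsOfSize.{0, 0} (Ind.inclusion C) :=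
    preservesFilteredColimitsOfSize_of_univLE.{v, v} _
  have h₃ : PreservesColimitsOfShape J (Ind.inclusion C) := h₂.preserves_filtered_colimits J
  exact preservesColimitsOfShape_of_natIso (coyonedaIndYoneda P).symm

/-- The structure maps of a formal colimit. -/
def indι {J : Type} [SmallCategory J] [IsFiltered J] (Y : J ⥤ C) (j : J) :
    Ind.yoneda.obj (Y.obj j) ⟶ (indLim J).obj Y :=
  colimit.ι (Y ⋙ Ind.yoneda) j

theorem indLim_hom_ext {J : Type} [SmallCategory J] [IsFiltered J] {Y : J ⥤ C} {P : Ind C}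
    {f g : (indLim J).obj Y ⟶ P} (h : ∀ j, indι Y j ≫ f = indι Y j ≫ g) : f = g :=
  colimit.hom_ext h

theorem indι_w {J : Type} [SmallCategory J] [IsFiltered J] (Y : J ⥤ C) {j j' : J} (f : j ⟶ j') :
    Ind.yoneda.map (Y.map f) ≫ indι Y j' = indι Y j :=
  colimit.w (Y ⋙ Ind.yoneda) f

theorem indι_map {J : Type} [SmallCategory J] [IsFiltered J] {Y Z : J ⥤ C} (f : Y ⟶ Z) (j : J) :
    indι Y j ≫ (indLim J).map f = Ind.yoneda.map (f.app j) ≫ indι Z j :=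
  ι_colimMap (Functor.whiskerRight f Ind.yoneda) j

/-- Surjective half of compactness; `exists_eq_of_indι_eq` is the injective half. -/
theorem exists_factor_indι {J : Type} [SmallCategory J] [IsFiltered J] (Y : J ⥤ C) {P : C}
    (f : Ind.yoneda.obj P ⟶ (indLim J).obj Y) :
    ∃ (j : J) (g : P ⟶ Y.obj j), Ind.yoneda.map g ≫ indι Y j = f := by
  have := preservesColimitsOfShape_coyonedaIndYoneda P J
  obtain ⟨j, g, hg⟩ := Types.jointly_surjective_of_isColimit
    (isColimitOfPreserves (coyoneda.obj (op (Ind.yoneda.obj P)))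
      (colimit.isColimit (Y ⋙ Ind.yoneda))) f
  refine ⟨j, Ind.yoneda.preimage g, ?_⟩
  rw [Functor.map_preimage]
  exact hg

theorem exists_eq_of_indι_eq {J : Type} [SmallCategory J] [IsFiltered J] (Y : J ⥤ C) {P : C}
    {j : J} (f g : P ⟶ Y.obj j)
    (h : Ind.yoneda.map f ≫ indι Y j = Ind.yoneda.map g ≫ indι Y j) :
    ∃ (j' : J) (t : j ⟶ j'), f ≫ Y.map t = g ≫ Y.map t := by
  have := preservesColimitsOfShape_coyonedaIndYoneda P J
  obtain ⟨j', t, ht⟩ := (Types.FilteredColimit.isColimit_eq_iff' (isColimitOfPreserves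
    (coyoneda.obj (op (Ind.yoneda.obj P))) (colimit.isColimit (Y ⋙ Ind.yoneda)))
    (Ind.yoneda.map f) (Ind.yoneda.map g)).1 h
  refine ⟨j', t, Ind.yoneda.map_injective ?_⟩
  rw [Functor.map_comp, Functor.map_comp]
  exact ht

variable (C) in
/-- The embedding of a category in its pro-objects. -/
abbrev proConst : C ⥤ Pro C := (Ind.yoneda (C := Cᵒᵖ)).rightOp

/-- The opposite of a formal limit is a colimit of ind-objects. -/
def proLimUnopIsColimit {I : Type} [SmallCategory I] [IsFiltered I] (Y : Iᵒᵖ ⥤ C) :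
    IsColimit (coconeUnopOfCone (limit.cone (Y ⋙ proConst C))) :=
  isColimitCoconeUnopOfCone _ (limit.isLimit (Y ⋙ proConst C))

/-- Compactness of `op a` in `Ind Cᵒᵖ`, read in the opposite category. -/
theorem exists_factor_proπ {I : Type} [SmallCategory I] [IsFiltered I] (Y : Iᵒᵖ ⥤ C) {a : C}
    (f : (proLim I).obj Y ⟶ (proConst C).obj a) :
    ∃ (i : I) (g : Y.obj (op i) ⟶ a), proπ Y i ≫ (proConst C).map g = f := by
  have := preservesColimitsOfShape_coyonedaIndYoneda (op a) I
  obtain ⟨i, g, hg⟩ := Types.jointly_surjective_of_isColimit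
    (isColimitOfPreserves (coyoneda.obj (op (Ind.yoneda.obj (op a)))) (proLimUnopIsColimit Y))
    f.unop
  obtain ⟨g, rfl⟩ := (Ind.yoneda (C := Cᵒᵖ)).map_surjective g
  exact ⟨i, g.unop, Quiver.Hom.unop_inj hg⟩

theorem exists_eq_of_proπ_eq {I : Type} [SmallCategory I] [IsFiltered I] (Y : Iᵒᵖ ⥤ C) {a : C}
    {i : I} (f g : Y.obj (op i) ⟶ a)
    (h : proπ Y i ≫ (proConst C).map f = proπ Y i ≫ (proConst C).map g) :
    ∃ (i' : I) (t : i ⟶ i'), Y.map t.op ≫ f = Y.map t.op ≫ g := by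
  have := preservesColimitsOfShape_coyonedaIndYoneda (op a) I
  obtain ⟨i', t, ht⟩ := (Types.FilteredColimit.isColimit_eq_iff' (isColimitOfPreserves
    (coyoneda.obj (op (Ind.yoneda.obj (op a)))) (proLimUnopIsColimit Y))
    (Ind.yoneda.map f.op) (Ind.yoneda.map g.op)).1 (congrArg Quiver.Hom.unop h)
  refine ⟨i', t, (proConst C).map_injective (Quiver.Hom.unop_inj ?_)⟩
  rw [Functor.map_comp, Functor.map_comp]
  exact ht

end IndProHoms

/-! ### Formal limits of functors on `Wedge`, and faithfulness. -/

section WedgePro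

variable {A : Type u} [Category.{v} A]

/-- The ind-system of pro-objects `"lim"_{i ≤ j} X_{i,j}` of `X : Wedge ⥤ A`. -/
def wedgePro (X : Wedge ⥤ A) : ℤ ⥤ Pro A := extend.obj X ⋙ proLim ℤᵒᵈ

/-- The map of ind-systems induced by a transformation. -/
def wedgeProMap {X Y : Wedge ⥤ A} (g : X ⟶ Y) : wedgePro X ⟶ wedgePro Y :=
  Functor.whiskerRight (extend.map g) (proLim ℤᵒᵈ)

/-- The structure maps of the ind-object `wedgeLim X`. -/
def wedgeι (X : Wedge ⥤ A) (j : ℤ) :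
    Ind.yoneda.obj ((wedgePro X).obj j) ⟶ wedgeLim.obj X :=
  indι (wedgePro X) j

/-- The projection `"lim"_{i ≤ j} X_{i,j} ⟶ X_{i,j}`, continued by the one to `X_{j,j}`. -/
def wedgeπMin (X : Wedge ⥤ A) (i j : ℤ) :
    (wedgePro X).obj j ⟶ (proConst A).obj (X.obj (Wedge.mk (min i j) j (min_le_right i j))) :=
  proπ ((extend.obj X).obj j) (OrderDual.toDual i)

theorem wedgeπMin_w (X : Wedge ⥤ A) {i i' : ℤ} (h : i ≤ i') (j : ℤ) :
    wedgeπMin X i j ≫ (proConst A).map (X.map (Wedge.hom (min_le_right i j) (min_le_right i' j)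
      (min_le_min h le_rfl) le_rfl)) = wedgeπMin X i' j :=
  proπ_w ((extend.obj X).obj j) (i := OrderDual.toDual i') (i' := OrderDual.toDual i) (homOfLE h)

theorem wedgePro_map_πMin (X : Wedge ⥤ A) (i : ℤ) {j j' : ℤ} (h : j ≤ j') :
    (wedgePro X).map (homOfLE h) ≫ wedgeπMin X i j' =
      wedgeπMin X i j ≫ (proConst A).map (X.map (Wedge.hom (min_le_right i j) (min_le_right i j')
        (min_le_min le_rfl h) h)) :=
  proLim_map_π ((extend.obj X).map (homOfLE h)) (OrderDual.toDual i)

theorem wedgeProMap_πMin {X Y : Wedge ⥤ A} (g : X ⟶ Y) (i j : ℤ) :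
    (wedgeProMap g).app j ≫ wedgeπMin Y i j =
      wedgeπMin X i j ≫ (proConst A).map (g.app (Wedge.mk (min i j) j (min_le_right i j))) :=
  proLim_map_π ((extend.map g).app j) (OrderDual.toDual i)

theorem wedgePro_hom_ext_min {X : Wedge ⥤ A} {j : ℤ} {P : Pro A} {f g : P ⟶ (wedgePro X).obj j}
    (h : ∀ i : ℤ, f ≫ wedgeπMin X i j = g ≫ wedgeπMin X i j) : f = g :=
  proLim_hom_ext fun i => h (OrderDual.ofDual i)

theorem exists_factor_wedgeπMin (X : Wedge ⥤ A) {j : ℤ} {a : A}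
    (f : (wedgePro X).obj j ⟶ (proConst A).obj a) :
    ∃ (i : ℤ) (g : X.obj (Wedge.mk (min i j) j (min_le_right i j)) ⟶ a),
      wedgeπMin X i j ≫ (proConst A).map g = f :=
  exists_factor_proπ ((extend.obj X).obj j) f

theorem exists_eq_of_wedgeπMin_eq (X : Wedge ⥤ A) {i j : ℤ} {a : A}
    (f g : X.obj (Wedge.mk (min i j) j (min_le_right i j)) ⟶ a)
    (h : wedgeπMin X i j ≫ (proConst A).map f = wedgeπMin X i j ≫ (proConst A).map g) :
    ∃ (i' : ℤ) (hi : i' ≤ i),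
      X.map (Wedge.hom (min_le_right i' j) (min_le_right i j) (min_le_min hi le_rfl) le_rfl) ≫ f =
        X.map (Wedge.hom (min_le_right i' j) (min_le_right i j) (min_le_min hi le_rfl) le_rfl) ≫
          g := by
  obtain ⟨i', t, ht⟩ := exists_eq_of_proπ_eq ((extend.obj X).obj j) f g h
  exact ⟨OrderDual.ofDual i', t.le, ht⟩

theorem exists_wedgePro_lift_min (X : Wedge ⥤ A) {j : ℤ} {P : Pro A}
    (f : ∀ i : ℤ, P ⟶ (proConst A).obj (X.obj (Wedge.mk (min i j) j (min_le_right i j))))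
    (hf : ∀ (i i' : ℤ) (h : i ≤ i'),
      f i ≫ (proConst A).map (X.map (Wedge.hom (min_le_right i j) (min_le_right i' j)
        (min_le_min h le_rfl) le_rfl)) = f i') :
    ∃ g : P ⟶ (wedgePro X).obj j, ∀ i : ℤ, g ≫ wedgeπMin X i j = f i :=
  let c : Cone ((extend.obj X).obj j ⋙ proConst A) :=
    { pt := P
      π :=
        { app := fun i => f (OrderDual.ofDual i.unop)
          naturality := fun _ _ t => (Category.id_comp _).trans (hf _ _ t.unop.le).symm } }
  ⟨limit.lift _ c, fun i => limit.lift_π c (op (OrderDual.toDual i))⟩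

/-- The projection `"lim"_{i ≤ j} X_{i,j} ⟶ X_{i,j}`. -/
def wedgeπ (X : Wedge ⥤ A) {i j : ℤ} (h : i ≤ j) :
    (wedgePro X).obj j ⟶ (proConst A).obj (X.obj (Wedge.mk i j h)) :=
  wedgeπMin X i j ≫
    (proConst A).map (X.map (Wedge.hom (min_le_right i j) h (min_le_left i j) le_rfl))

theorem wedge_map_comp (X : Wedge ⥤ A) {p q r : Wedge} (f : p ⟶ q) (g : q ⟶ r) (h : p ⟶ r) :
    X.map f ≫ X.map g = X.map h :=
  (X.map_comp f g).symm

theorem wedgePro_map_refl (X : Wedge ⥤ A) {j : ℤ} (h : j ≤ j) :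
    (wedgePro X).map (homOfLE h) = 𝟙 _ :=
  (wedgePro X).map_id j

theorem wedgeπMin_eq (X : Wedge ⥤ A) (i j : ℤ) :
    wedgeπMin X i j = wedgeπ X (min_le_right i j) := by
  rw [wedgeπ, ← wedgeπMin_w X (min_le_left i j) j]

theorem wedgeπ_map (X : Wedge ⥤ A) {i j i' j' : ℤ} (h : i ≤ j) (h' : i' ≤ j') (hi : i ≤ i')
    (hj : j ≤ j') :
    wedgeπ X h ≫ (proConst A).map (X.map (Wedge.hom h h' hi hj)) =
      (wedgePro X).map (homOfLE hj) ≫ wedgeπ X h' := by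
  rw [wedgeπ, wedgeπ, reassoc_of% wedgePro_map_πMin, ← wedgeπMin_w X hi j, Category.assoc,
    Category.assoc]
  simp only [← Functor.map_comp]
  rfl

theorem wedgeπ_w (X : Wedge ⥤ A) {i i' j : ℤ} (hi : i ≤ i') (h' : i' ≤ j) :
    wedgeπ X (hi.trans h') ≫
      (proConst A).map (X.map (Wedge.hom (hi.trans h') h' hi le_rfl)) = wedgeπ X h' := by
  rw [wedgeπ_map, wedgePro_map_refl, Category.id_comp]

theorem wedgeProMap_π {X Y : Wedge ⥤ A} (g : X ⟶ Y) {i j : ℤ} (h : i ≤ j) :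
    (wedgeProMap g).app j ≫ wedgeπ Y h =
      wedgeπ X h ≫ (proConst A).map (g.app (Wedge.mk i j h)) := by
  rw [wedgeπ, wedgeπ, reassoc_of% wedgeProMap_πMin, Category.assoc, ← Functor.map_comp,
    ← Functor.map_comp, g.naturality]

/-- The indices `i ≤ b` are cofinal towards `-∞`. The bound allows comparison with a step `b` below
`j`, whose own projections exist only for `i ≤ b`. -/
theorem wedgePro_hom_ext {X : Wedge ⥤ A} {j : ℤ} (b : ℤ) (hb : b ≤ j) {P : Pro A}
    {f g : P ⟶ (wedgePro X).obj j}
    (h : ∀ (i : ℤ) (hi : i ≤ b), f ≫ wedgeπ X (hi.trans hb) = g ≫ wedgeπ X (hi.trans hb)) :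
    f = g := by
  apply wedgePro_hom_ext_min
  intro i
  have e : min i b ≤ min i j := min_le_min le_rfl hb
  rw [wedgeπMin_eq, ← wedgeπ_w X e (min_le_right i j), reassoc_of% h _ (min_le_right i b)]

theorem exists_wedgePro_lift (X : Wedge ⥤ A) {j : ℤ} (b : ℤ) (hb : b ≤ j) {P : Pro A}
    (f : ∀ (i : ℤ) (hi : i ≤ b), P ⟶ (proConst A).obj (X.obj (Wedge.mk i j (hi.trans hb))))
    (hf : ∀ (i i' : ℤ) (h : i ≤ i') (hi' : i' ≤ b),
      f i (h.trans hi') ≫ (proConst A).map (X.map (Wedge.hom _ _ h le_rfl)) = f i' hi') :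
    ∃ g : P ⟶ (wedgePro X).obj j, ∀ (i : ℤ) (hi : i ≤ b), g ≫ wedgeπ X (hi.trans hb) = f i hi := by
  obtain ⟨g, hg⟩ := exists_wedgePro_lift_min X (j := j)
    (fun i => f (min i b) (min_le_right i b) ≫ (proConst A).map (X.map (Wedge.hom
      ((min_le_right i b).trans hb) (min_le_right i j) (min_le_min le_rfl hb) le_rfl)))
    (fun i i' h => by
      rw [← hf _ _ (min_le_min h le_rfl) (min_le_right i' b), Category.assoc, Category.assoc]
      simp only [← Functor.map_comp]
      rfl)
  refine ⟨g, fun i hi => ?_⟩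
  rw [wedgeπ, reassoc_of% hg i, ← Functor.map_comp,
    wedge_map_comp X _ _ (Wedge.hom _ _ (min_le_left i b) le_rfl)]
  exact hf (min i b) i _ hi

theorem exists_factor_wedgeπ (X : Wedge ⥤ A) {j : ℤ} (b : ℤ) {a : A}
    (f : (wedgePro X).obj j ⟶ (proConst A).obj a) :
    ∃ (i : ℤ) (hi : i ≤ j) (_ : i ≤ b) (g : X.obj (Wedge.mk i j hi) ⟶ a),
      wedgeπ X hi ≫ (proConst A).map g = f := by
  obtain ⟨i, g, rfl⟩ := exists_factor_wedgeπMin X f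
  -- Any smaller index also represents the map; going below `b` lets two factorizations share a
  -- stage.
  have e : min (min i j) b ≤ min i j := min_le_left _ _
  refine ⟨min (min i j) b, e.trans (min_le_right i j), min_le_right _ _,
    X.map (Wedge.hom _ (min_le_right i j) e le_rfl) ≫ g, ?_⟩
  rw [Functor.map_comp, reassoc_of% wedgeπ_w X e (min_le_right i j), wedgeπMin_eq]

theorem wedgeι_w (X : Wedge ⥤ A) {j j' : ℤ} (h : j ≤ j') :
    Ind.yoneda.map ((wedgePro X).map (homOfLE h)) ≫ wedgeι X j' = wedgeι X j :=
  indι_w _ _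

theorem wedgeι_map {X Y : Wedge ⥤ A} (g : X ⟶ Y) (j : ℤ) :
    wedgeι X j ≫ wedgeLim.map g = Ind.yoneda.map ((wedgeProMap g).app j) ≫ wedgeι Y j :=
  indι_map (wedgeProMap g) j

theorem wedgeLim_hom_ext {X : Wedge ⥤ A} {P : Ind (Pro A)} {f g : wedgeLim.obj X ⟶ P}
    (h : ∀ j, wedgeι X j ≫ f = wedgeι X j ≫ g) : f = g :=
  indLim_hom_ext h

variable [Preadditive A] [HasZeroObject A] [HasBinaryBiproducts A] {𝓔 : ExactStructure A}

theorem IsAdmEpi.epi {b c : A} {g : b ⟶ c} (hg : IsAdmEpi 𝓔.E g) : Epi g := by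
  obtain ⟨a, f, w, h⟩ := hg
  obtain ⟨k⟩ := 𝓔.isCokernel _ h
  exact epi_of_isColimit_cofork k

theorem IsAdmMono.mono {a b : A} {f : a ⟶ b} (hf : IsAdmMono 𝓔.E f) : Mono f := by
  obtain ⟨c, g, w, h⟩ := hf
  obtain ⟨k⟩ := 𝓔.isKernel _ h
  exact mono_of_isLimit_fork k

/-- A priori the two maps agree only after restriction to a further stage, but the transition map
from there is an admissible epimorphism and cancels. -/
theorem isAdm.wedgeπ_cancel {X : Wedge ⥤ A} (hX : isAdm 𝓔 X) {i j : ℤ} (h : i ≤ j) {a : A}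
    {f g : X.obj (Wedge.mk i j h) ⟶ a}
    (e : wedgeπ X h ≫ (proConst A).map f = wedgeπ X h ≫ (proConst A).map g) : f = g := by
  rw [wedgeπ, Category.assoc, Category.assoc, ← Functor.map_comp, ← Functor.map_comp] at e
  obtain ⟨i', hi, ht⟩ := exists_eq_of_wedgeπMin_eq X _ _ e
  have hi' : min i' j ≤ i := (min_le_left i' j).trans hi
  have e₁ := wedge_map_comp X
    (Wedge.hom (min_le_right i' j) (min_le_right i j) (min_le_min hi le_rfl) le_rfl)
    (Wedge.hom (min_le_right i j) h (min_le_left i j) le_rfl)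
    (Wedge.hom (hi'.trans h) h hi' le_rfl)
  rw [reassoc_of% e₁, reassoc_of% e₁] at ht
  have := (hX.admEpi hi' h).epi
  exact (cancel_epi _).1 ht

/-- Both maps are represented on a common `X_{i',n}`, and by `wedgeπ_cancel` the equality already
holds in `A`, where `m` cancels. -/
theorem isAdm.proConst_mono_cancel {X : Wedge ⥤ A} (hX : isAdm 𝓔 X) {n : ℤ} {a b : A} (m : a ⟶ b)
    [Mono m] {f g : (wedgePro X).obj n ⟶ (proConst A).obj a}
    (h : f ≫ (proConst A).map m = g ≫ (proConst A).map m) : f = g := by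
  obtain ⟨i, hi, -, f, rfl⟩ := exists_factor_wedgeπ X n f
  obtain ⟨i', hi', hii', g, rfl⟩ := exists_factor_wedgeπ X i g
  rw [← wedgeπ_w X hii' hi] at h ⊢
  simp only [Category.assoc, ← Functor.map_comp] at h ⊢
  have h' := hX.wedgeπ_cancel _ h
  rw [← Category.assoc, cancel_mono] at h'
  rw [h']

theorem isAdm.wedgePro_map_cancel {X Y : Wedge ⥤ A} (hX : isAdm 𝓔 X) (hY : isAdm 𝓔 Y) {n l l' : ℤ}
    (hl : l ≤ l') {f g : (wedgePro X).obj n ⟶ (wedgePro Y).obj l}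
    (h : f ≫ (wedgePro Y).map (homOfLE hl) = g ≫ (wedgePro Y).map (homOfLE hl)) : f = g := by
  apply wedgePro_hom_ext l le_rfl
  intro i hi
  have := (hY.admMono hi hl).mono
  apply hX.proConst_mono_cancel (Y.map (Wedge.hom hi (hi.trans hl) le_rfl hl))
  rw [Category.assoc, Category.assoc, wedgeπ_map, reassoc_of% h]

/-- The equality holds in some later step of `Y`, and the map to that step is levelwise an
admissible monomorphism. -/
theorem isAdm.wedgeι_cancel {X Y : Wedge ⥤ A} (hX : isAdm 𝓔 X) (hY : isAdm 𝓔 Y) {n l : ℤ}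
    {f g : (wedgePro X).obj n ⟶ (wedgePro Y).obj l}
    (h : Ind.yoneda.map f ≫ wedgeι Y l = Ind.yoneda.map g ≫ wedgeι Y l) : f = g := by
  obtain ⟨l', t, ht⟩ := exists_eq_of_indι_eq _ _ _ h
  exact hX.wedgePro_map_cancel hY t.le ht

/-- The functor `wedgeLim` is faithful on admissible functors. -/
theorem isAdm.wedgeLim_map_injective {X Y : Wedge ⥤ A} (hX : isAdm 𝓔 X) (hY : isAdm 𝓔 Y)
    {f g : X ⟶ Y} (h : wedgeLim.map f = wedgeLim.map g) : f = g := by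
  ext ⟨⟨i, j⟩, hij⟩
  -- The component at `(i, j)` is recovered in two cancellations: from the pro-map at step `j`, and
  -- that one from the map of ind-objects.
  apply hX.wedgeπ_cancel
  rw [← wedgeProMap_π, ← wedgeProMap_π]
  congr 1
  apply hX.wedgeι_cancel hY
  rw [← wedgeι_map, ← wedgeι_map, h]

end WedgePro

/-! ### Maps between formal limits as fractions. -/

section Roofs

variable {A : Type u} [Category.{v} A]

/-- The map `Y ⟶ Y ∘ φ̃` for `φ` above the identity. -/
def toTilde (Y : Wedge ⥤ A) (φ : Bicofinal) (h : ∀ n, n ≤ φ.toFun n) : Y ⟶ φ.tilde ⋙ Y where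
  app p := Y.map (Wedge.hom p.2 (φ.mono p.2) (h p.1.1) (h p.1.2))
  naturality _ _ _ := wedge_comp Y _ _ _ _

/-- `f` carries the `n`-th step of `wedgeLim X` to the `l`-th step of `wedgeLim Y`. -/
def MapsInto {X Y : Wedge ⥤ A} (f : wedgeLim.obj X ⟶ wedgeLim.obj Y) (n l : ℤ) : Prop :=
  ∃ h : (wedgePro X).obj n ⟶ (wedgePro Y).obj l,
    Ind.yoneda.map h ≫ wedgeι Y l = wedgeι X n ≫ f

theorem MapsInto.mono {X Y : Wedge ⥤ A} {f : wedgeLim.obj X ⟶ wedgeLim.obj Y} {n n' l l' : ℤ}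
    (h : MapsInto f n l) (hn : n' ≤ n) (hl : l ≤ l') : MapsInto f n' l' := by
  obtain ⟨h, e⟩ := h
  refine ⟨(wedgePro X).map (homOfLE hn) ≫ h ≫ (wedgePro Y).map (homOfLE hl), ?_⟩
  rw [Functor.map_comp, Functor.map_comp, Category.assoc, Category.assoc, wedgeι_w, e,
    reassoc_of% wedgeι_w X hn]

theorem exists_mapsInto {X Y : Wedge ⥤ A} (f : wedgeLim.obj X ⟶ wedgeLim.obj Y) (n b : ℤ) :
    ∃ l, b ≤ l ∧ MapsInto f n l := by
  obtain ⟨l, h, e⟩ := exists_factor_indι (wedgePro Y) (wedgeι X n ≫ f)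
  exact ⟨max b l, le_max_left _ _, MapsInto.mono (l := l) ⟨h, e⟩ le_rfl (le_max_right _ _)⟩

variable [Preadditive A]

/-- The zero map from a step of `wedgeLim X` to an object of `A`. -/
def wedgeZero (X : Wedge ⥤ A) (n : ℤ) (a : A) : (wedgePro X).obj n ⟶ (proConst A).obj a :=
  wedgeπ X (le_refl n) ≫ (proConst A).map 0

/-- No additive structure on `Pro A` is used: a zero map is one represented by zero in `A`, and the
representing stage is irrelevant. -/
theorem wedgeπ_map_zero (X : Wedge ⥤ A) {i n : ℤ} (h : i ≤ n) (a : A) :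
    wedgeπ X h ≫ (proConst A).map 0 = wedgeZero X n a := by
  rw [wedgeZero, ← wedgeπ_w X h le_rfl, Category.assoc, ← Functor.map_comp, comp_zero]

variable [HasZeroObject A] [HasBinaryBiproducts A] {𝓔 : ExactStructure A}

theorem isAdm.isZero_diag {X : Wedge ⥤ A} (hX : isAdm 𝓔 X) (i : ℤ) :
    IsZero (X.obj (Wedge.mk i i le_rfl)) := by
  obtain ⟨w, -⟩ := hX i i i le_rfl le_rfl
  rw [wedge_map_comp X _ _ (𝟙 _), X.map_id] at w
  exact (IsZero.iff_id_eq_zero _).2 w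

/-- The composite passes through `X_{i,i}`, which is zero. -/
theorem isAdm.wedgePro_map_π {X : Wedge ⥤ A} (hX : isAdm 𝓔 X) {i j : ℤ} (h : i ≤ j) :
    (wedgePro X).map (homOfLE h) ≫ wedgeπ X h = wedgeZero X i _ := by
  rw [← wedgeπ_map X le_rfl h le_rfl h, (hX.isZero_diag i).eq_zero_of_src (X.map _), wedgeZero]

/-- `X_{i,j}` serves as the quotient `X_j / X_i` for maps to objects of `A`: a representative of `u`
on `X_{i',j}`, `i' ≤ i`, kills `X_{i',i}` and descends to the cokernel. -/
theorem isAdm.exists_desc {X : Wedge ⥤ A} (hX : isAdm 𝓔 X) {i j : ℤ} (hij : i ≤ j) {a : A}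
    (u : (wedgePro X).obj j ⟶ (proConst A).obj a)
    (hu : (wedgePro X).map (homOfLE hij) ≫ u = wedgeZero X i a) :
    ∃ g : X.obj (Wedge.mk i j hij) ⟶ a, wedgeπ X hij ≫ (proConst A).map g = u := by
  obtain ⟨i', hi'j, hi'i, g', rfl⟩ := exists_factor_wedgeπ X i u
  obtain ⟨w, hw⟩ := hX i' i j hi'i hij
  obtain ⟨k⟩ := 𝓔.isCokernel _ hw
  have hz : X.map (Wedge.hom hi'i (hi'i.trans hij) le_rfl hij) ≫ g' = 0 := by
    apply hX.wedgeπ_cancel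
    rw [Functor.map_comp, reassoc_of% wedgeπ_map X hi'i (hi'i.trans hij) le_rfl hij, hu,
      wedgeπ_map_zero]
  let g : X.obj (Wedge.mk i j hij) ⟶ a := k.desc (CokernelCofork.ofπ g' hz)
  have hg : X.map (Wedge.hom (hi'i.trans hij) hij hi'i le_rfl) ≫ g = g' :=
    k.fac (CokernelCofork.ofπ g' hz) WalkingParallelPair.one
  refine ⟨g, ?_⟩
  rw [← wedgeπ_w X hi'i hij, Category.assoc, ← Functor.map_comp, hg]

/-- `Y_k` serves as the kernel of `Y_l ⟶ Y_{k,l}`: for each `i ≤ k` the kernel `Y_{i,k}` of `Y_{i,l}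
⟶ Y_{k,l}` receives a lift, and the lifts are compatible because `Y_{i,k} ⟶ Y_{i,l}` is mono. -/
theorem isAdm.exists_lift {X Y : Wedge ⥤ A} (hX : isAdm 𝓔 X) (hY : isAdm 𝓔 Y) {n k l : ℤ}
    (hkl : k ≤ l) (u : (wedgePro X).obj n ⟶ (wedgePro Y).obj l)
    (hu : u ≫ wedgeπ Y hkl = wedgeZero X n _) :
    ∃ g : (wedgePro X).obj n ⟶ (wedgePro Y).obj k, g ≫ (wedgePro Y).map (homOfLE hkl) = u := by
  have key : ∀ (i : ℤ) (hi : i ≤ k), ∃ v : (wedgePro X).obj n ⟶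
      (proConst A).obj (Y.obj (Wedge.mk i k (hi.trans le_rfl))),
      v ≫ (proConst A).map (Y.map (Wedge.hom hi (hi.trans hkl) le_rfl hkl)) =
        u ≫ wedgeπ Y (hi.trans hkl) := by
    intro i hi
    obtain ⟨m, hm, -, t, ht⟩ := exists_factor_wedgeπ X n (u ≫ wedgeπ Y (hi.trans hkl))
    obtain ⟨w, hw⟩ := hY i k l hi hkl
    obtain ⟨c⟩ := 𝓔.isKernel _ hw
    have hz : t ≫ Y.map (Wedge.hom (hi.trans hkl) hkl hi le_rfl) = 0 := by
      apply hX.wedgeπ_cancel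
      rw [Functor.map_comp, reassoc_of% ht, wedgeπ_w, hu, wedgeπ_map_zero]
    let s : X.obj (Wedge.mk m n hm) ⟶ Y.obj (Wedge.mk i k hi) := c.lift (KernelFork.ofι t hz)
    have hs : s ≫ Y.map (Wedge.hom hi (hi.trans hkl) le_rfl hkl) = t :=
      c.fac (KernelFork.ofι t hz) WalkingParallelPair.zero
    refine ⟨wedgeπ X hm ≫ (proConst A).map s, ?_⟩
    rw [Category.assoc, ← Functor.map_comp, hs, ht]
  choose v hv using key
  obtain ⟨g, hg⟩ := exists_wedgePro_lift Y k le_rfl v (fun i i' h hi' => by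
    have := (hY.admMono hi' hkl).mono
    apply hX.proConst_mono_cancel (Y.map (Wedge.hom hi' (hi'.trans hkl) le_rfl hkl))
    rw [hv, Category.assoc, ← Functor.map_comp, wedge_comp Y _ _
      (Wedge.hom (h.trans hi') ((h.trans hi').trans hkl) le_rfl hkl)
      (Wedge.hom ((h.trans hi').trans hkl) (hi'.trans hkl) h le_rfl), Functor.map_comp,
      reassoc_of% hv, wedgeπ_w])
  refine ⟨g, wedgePro_hom_ext k hkl fun i hi => ?_⟩
  rw [Category.assoc, ← wedgeπ_map Y hi (hi.trans hkl) le_rfl hkl, reassoc_of% hg i hi, hv]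

/-- This gives the limit at `-∞` of the index map of a fraction. The step `X_0`, an arbitrary
choice, lands in some `Y_l`; its map to `Y_{k,l}` is represented on some `X_{i,0}`, hence kills
`X_i`, so `X_i` lands in `Y_k`. -/
theorem isAdm.exists_mapsInto_of_le {X Y : Wedge ⥤ A} (hX : isAdm 𝓔 X) (hY : isAdm 𝓔 Y)
    (f : wedgeLim.obj X ⟶ wedgeLim.obj Y) (k : ℤ) : ∃ i, i ≤ k ∧ MapsInto f i k := by
  obtain ⟨l, hkl, h, e⟩ := exists_mapsInto f 0 k
  obtain ⟨i, hi, hik, g, hg⟩ := exists_factor_wedgeπ X k (h ≫ wedgeπ Y hkl)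
  obtain ⟨t, ht⟩ := hX.exists_lift hY hkl ((wedgePro X).map (homOfLE hi) ≫ h) (by
    rw [Category.assoc, ← hg, reassoc_of% hX.wedgePro_map_π hi, wedgeZero, Category.assoc,
      ← Functor.map_comp, zero_comp, wedgeZero])
  refine ⟨i, hik, t, ?_⟩
  rw [← wedgeι_w Y hkl, ← Functor.map_comp_assoc, ht, Functor.map_comp, Category.assoc, e,
    reassoc_of% wedgeι_w X hi]

/-- Every map between the formal limits of admissible functors is a fraction. -/
theorem isAdm.exists_fraction {X Y : Wedge ⥤ A} (hX : isAdm 𝓔 X) (hY : isAdm 𝓔 Y)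
    (f : wedgeLim.obj X ⟶ wedgeLim.obj Y) :
    ∃ (φ : Bicofinal) (hφ : ∀ n, n ≤ φ.toFun n) (g : X ⟶ φ.tilde ⋙ Y),
      wedgeLim.map g = f ≫ wedgeLim.map (toTilde Y φ hφ) := by
  -- Requiring `n ≤ l` bounds the candidates below, so that a least one exists, and puts `φ` above
  -- the identity.
  have key : ∀ n, ∃ l, (n ≤ l ∧ MapsInto f n l) ∧ ∀ z, (n ≤ z ∧ MapsInto f n z) → l ≤ z :=
    fun n => Int.exists_least_of_bdd ⟨n, fun z hz => hz.1⟩ (exists_mapsInto f n n)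
  choose φ hφ hmin using key
  have hmono : ∀ {n n' : ℤ}, n ≤ n' → φ n ≤ φ n' := fun {n n'} h =>
    hmin n _ ⟨h.trans (hφ n').1, (hφ n').2.mono h le_rfl⟩
  let Φ : Bicofinal :=
    { toFun := φ
      mono := fun _ _ => hmono
      tendsto_atTop := Filter.tendsto_atTop_mono (fun n => (hφ n).1) Filter.tendsto_id
      tendsto_atBot := Filter.tendsto_atBot.2 fun k => by
        obtain ⟨i, hik, hi⟩ := hX.exists_mapsInto_of_le hY f k
        exact Filter.eventually_atBot.2 ⟨i, fun n hn => (hmono hn).trans (hmin i k ⟨hik, hi⟩)⟩ }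
  choose h hh using fun n => (hφ n).2
  have hnat : ∀ (n n' : ℤ) (e : n ≤ n'), (wedgePro X).map (homOfLE e) ≫ h n' =
      h n ≫ (wedgePro Y).map (homOfLE (hmono e)) := by
    intro n n' e
    apply hX.wedgeι_cancel hY
    rw [Functor.map_comp, Functor.map_comp, Category.assoc, Category.assoc, wedgeι_w, hh, hh,
      reassoc_of% wedgeι_w X e]
  have hg : ∀ (i j : ℤ) (hij : i ≤ j),
      ∃ g : X.obj (Wedge.mk i j hij) ⟶ Y.obj (Wedge.mk (φ i) (φ j) (hmono hij)),
        wedgeπ X hij ≫ (proConst A).map g = h j ≫ wedgeπ Y (hmono hij) := by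
    intro i j hij
    -- `X_i` is carried into `Y_{φ i}`, which vanishes in `Y_{φ i, φ j}`.
    apply hX.exists_desc hij
    obtain ⟨m, hm, -, t, ht⟩ := exists_factor_wedgeπ X i (h i ≫ wedgeπ Y (le_refl (φ i)))
    rw [reassoc_of% hnat i j hij, hY.wedgePro_map_π, wedgeZero, ← reassoc_of% ht,
      ← Functor.map_comp, comp_zero, wedgeπ_map_zero]
  choose g hg using hg
  have hgnat : ∀ (i j i' j' : ℤ) (hij : i ≤ j) (hij' : i' ≤ j') (hi : i ≤ i') (hj : j ≤ j'),
      X.map (Wedge.hom hij hij' hi hj) ≫ g i' j' hij' =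
        g i j hij ≫ Y.map (Wedge.hom (hmono hij) (hmono hij') (hmono hi) (hmono hj)) := by
    intro i j i' j' hij hij' hi hj
    apply hX.wedgeπ_cancel hij
    rw [Functor.map_comp, Functor.map_comp, reassoc_of% wedgeπ_map X hij hij' hi hj, hg,
      reassoc_of% hg, reassoc_of% hnat j j' hj, wedgeπ_map]
  let G : X ⟶ Φ.tilde ⋙ Y :=
    { app := fun p => g p.1.1 p.1.2 p.2
      naturality := fun p q t => hgnat _ _ _ _ p.2 q.2 t.le.1 t.le.2 }
  refine ⟨Φ, fun n => (hφ n).1, G, wedgeLim_hom_ext fun j => ?_⟩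
  -- On step `j` one side lands in step `j` of `Y ∘ φ̃` and the other in step `φ j`; they are
  -- compared in the latter, through the projections with index at most `j`.
  have hj : j ≤ φ j := (hφ j).1
  rw [wedgeι_map, ← reassoc_of% hh j, wedgeι_map, ← wedgeι_w (Φ.tilde ⋙ Y) hj,
    ← Functor.map_comp_assoc, ← Functor.map_comp_assoc]
  congr 2
  apply wedgePro_hom_ext j hj
  intro k hk
  rw [Category.assoc, ← wedgeπ_map (Φ.tilde ⋙ Y) hk (hk.trans hj) le_rfl hj,
    reassoc_of% wedgeProMap_π G hk, Category.assoc, wedgeProMap_π]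
  refine ((reassoc_of% hg k j hk) _).trans (congrArg (fun t => h j ≫ t) ?_)
  exact (wedgeπ_map Y (hmono hk) (hmono (hk.trans hj)) le_rfl (hmono hj)).trans
    (wedgeπ_map Y (hk.trans hj) (hmono (hk.trans hj)) (hφ k).1 (hmono hj)).symm

end Roofs

/-! ### Fractions in the Beilinson category, and full faithfulness. -/

section Localization

/-- The identity is bicofinal. -/
def Bicofinal.refl : Bicofinal := ⟨id, monotone_id, Filter.tendsto_id, Filter.tendsto_id⟩

/-- Bicofinal maps compose. -/
def Bicofinal.comp (ψ φ : Bicofinal) : Bicofinal :=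
  ⟨ψ.toFun ∘ φ.toFun, ψ.mono.comp φ.mono, ψ.tendsto_atTop.comp φ.tendsto_atTop,
    ψ.tendsto_atBot.comp φ.tendsto_atBot⟩

/-- The maximum of two bicofinal maps. -/
def Bicofinal.sup (φ ψ : Bicofinal) : Bicofinal where
  toFun n := max (φ.toFun n) (ψ.toFun n)
  mono _ _ h := max_le_max (φ.mono h) (ψ.mono h)
  tendsto_atTop := Filter.tendsto_atTop_mono (fun _ => le_max_left _ _) φ.tendsto_atTop
  tendsto_atBot := Filter.tendsto_atBot.2 fun b => by
    filter_upwards [φ.tendsto_atBot.eventually_le_atBot b, ψ.tendsto_atBot.eventually_le_atBot b]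
      with n h₁ h₂ using max_le h₁ h₂

/-- Take for `ψ n` the least `m ≥ n` with `φ₁ n ≤ φ₀ m`. It tends to `-∞` because `m = k` qualifies
as soon as `n ≤ k` and `φ₁ n ≤ φ₀ k`. -/
theorem Bicofinal.exists_le_comp (φ₀ φ₁ : Bicofinal) :
    ∃ ψ : Bicofinal, (∀ n, n ≤ ψ.toFun n) ∧ ∀ n, φ₁.toFun n ≤ φ₀.toFun (ψ.toFun n) := by
  have key : ∀ n, ∃ m, (n ≤ m ∧ φ₁.toFun n ≤ φ₀.toFun m) ∧
      ∀ z, (n ≤ z ∧ φ₁.toFun n ≤ φ₀.toFun z) → m ≤ z :=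
    fun n => Int.exists_least_of_bdd ⟨n, fun z hz => hz.1⟩
      ((Filter.eventually_ge_atTop n).and
        (φ₀.tendsto_atTop.eventually_ge_atTop (φ₁.toFun n))).exists
  choose ψ hψ hmin using key
  refine ⟨⟨ψ, fun n n' h => hmin n _ ⟨h.trans (hψ n').1, (φ₁.mono h).trans (hψ n').2⟩,
    Filter.tendsto_atTop_mono (fun n => (hψ n).1) Filter.tendsto_id,
    Filter.tendsto_atBot.2 fun k => ?_⟩, fun n => (hψ n).1, fun n => (hψ n).2⟩
  filter_upwards [Filter.eventually_le_atBot k,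
    φ₁.tendsto_atBot.eventually_le_atBot (φ₀.toFun k)] with n h₁ h₂ using hmin n k ⟨h₁, h₂⟩

variable {A : Type u} [Category.{v} A] [Preadditive A] [HasZeroObject A]
  [HasBinaryBiproducts A] {𝓔 : ExactStructure A}

/-- The canonical map `X ⟶ X ∘ φ̃` for `φ` above the identity. -/
def BiFunA.toPrecomp (X : BiFunA 𝓔) (φ : Bicofinal) (h : ∀ n, n ≤ φ.toFun n) :
    X ⟶ X.precomp φ :=
  ObjectProperty.homMk (toTilde X.obj φ h)

theorem BiFunA.toPrecomp_mem (X : BiFunA 𝓔) (φ : Bicofinal) (h : ∀ n, n ≤ φ.toFun n) :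
    Ua 𝓔 (X.toPrecomp φ h) :=
  Ua.mk X Bicofinal.refl φ h

/-- The map `X ∘ φ̃ ⟶ Y ∘ φ̃` induced by `X ⟶ Y`. -/
def BiFunA.precompMap {X Y : BiFunA 𝓔} (f : X ⟶ Y) (φ : Bicofinal) : X.precomp φ ⟶ Y.precomp φ :=
  ObjectProperty.homMk (Functor.whiskerLeft φ.tilde f.hom)

theorem BiFunA.toPrecomp_naturality {X Y : BiFunA 𝓔} (f : X ⟶ Y) (φ : Bicofinal)
    (h : ∀ n, n ≤ φ.toFun n) :
    f ≫ Y.toPrecomp φ h = X.toPrecomp φ h ≫ precompMap f φ := by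
  ext p
  exact (f.hom.naturality _).symm

theorem BiFunA.toPrecomp_comp (X : BiFunA 𝓔) (ψ φ : Bicofinal) (hψ : ∀ n, n ≤ ψ.toFun n)
    (hφ : ∀ n, n ≤ φ.toFun n) :
    X.toPrecomp (ψ.comp φ) (fun n => (hφ n).trans (hψ _)) =
      X.toPrecomp ψ hψ ≫ (X.precomp ψ).toPrecomp φ hφ := by
  ext p
  exact (wedge_map_comp X.obj _ _ _).symm

theorem BiFunA.toPrecomp_precompHom (X : BiFunA 𝓔) {φ ψ : Bicofinal} (hφ : ∀ n, n ≤ φ.toFun n)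
    (h : ∀ n, φ.toFun n ≤ ψ.toFun n) :
    X.toPrecomp φ hφ ≫ X.precompHom h = X.toPrecomp ψ (fun n => (hφ n).trans (h n)) := by
  ext p
  exact wedge_map_comp X.obj _ _ _

theorem BiFunA.precompHom_precompHom (X : BiFunA 𝓔) {φ₀ φ₁ ψ : Bicofinal}
    (h : ∀ n, φ₀.toFun n ≤ φ₁.toFun n) (hψ : ∀ n, n ≤ ψ.toFun n)
    (h' : ∀ n, φ₁.toFun n ≤ (φ₀.comp ψ).toFun n) :
    X.precompHom h ≫ X.precompHom h' = (X.precomp φ₀).toPrecomp ψ hψ := by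
  ext p
  exact wedge_map_comp X.obj _ _ _

/-- A map in the Beilinson category is a fraction with denominator `Y ⟶ Y ∘ φ̃`. -/
def IsFraction {X Y : BiFunA 𝓔} (α : (Ua 𝓔).Q.obj X ⟶ (Ua 𝓔).Q.obj Y) : Prop :=
  ∃ (φ : Bicofinal) (h : ∀ n, n ≤ φ.toFun n) (g : X ⟶ Y.precomp φ),
    α ≫ (Ua 𝓔).Q.map (Y.toPrecomp φ h) = (Ua 𝓔).Q.map g

/-- Naturality of `Y ⟶ Y ∘ φ̃` moves the numerator of `β` past the denominator of `α`, at the cost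
of precomposing it with `φ̃`. -/
theorem IsFraction.comp {X Y Z : BiFunA 𝓔} {α : (Ua 𝓔).Q.obj X ⟶ (Ua 𝓔).Q.obj Y}
    {β : (Ua 𝓔).Q.obj Y ⟶ (Ua 𝓔).Q.obj Z} (hα : IsFraction α) (hβ : IsFraction β) :
    IsFraction (α ≫ β) := by
  obtain ⟨φ, hφ, g, hg⟩ := hα
  obtain ⟨ψ, hψ, k, hk⟩ := hβ
  have key : (α ≫ β) ≫ (Ua 𝓔).Q.map (Z.toPrecomp ψ hψ ≫ (Z.precomp ψ).toPrecomp φ hφ) =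
      (Ua 𝓔).Q.map (g ≫ BiFunA.precompMap k φ) := by
    rw [Functor.map_comp, Category.assoc, reassoc_of% hk, ← Functor.map_comp,
      BiFunA.toPrecomp_naturality, Functor.map_comp, reassoc_of% hg, ← Functor.map_comp]
  exact ⟨ψ.comp φ, fun n => (hφ n).trans (hψ _), g ≫ BiFunA.precompMap k φ,
    (congrArg (fun t => (α ≫ β) ≫ (Ua 𝓔).Q.map t) (Z.toPrecomp_comp ψ φ hψ hφ)).trans key⟩

theorem isFraction_Q_map {X Y : BiFunA 𝓔} (f : X ⟶ Y) : IsFraction ((Ua 𝓔).Q.map f) :=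
  ⟨Bicofinal.refl, fun _ => le_rfl, f ≫ Y.toPrecomp _ (fun _ => le_rfl),
    ((Ua 𝓔).Q.map_comp _ _).symm⟩

/-- For `ψ` with `φ₁ ≤ φ₀ ∘ ψ`, the map `w` followed by `X ∘ φ̃₁ ⟶ X ∘ φ̃₀ ∘ ψ̃` is the canonical
denominator of `X ∘ φ̃₀`; so the second map is the numerator of the inverse. -/
theorem isFraction_wInv {X Y : BiFunA 𝓔} (w : X ⟶ Y) (hw : Ua 𝓔 w) :
    IsFraction (Localization.Construction.wInv w hw) := by
  obtain ⟨X, φ₀, φ₁, h⟩ := hw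
  obtain ⟨ψ, hψ, h'⟩ := Bicofinal.exists_le_comp φ₀ φ₁
  have h'' : ∀ n, φ₁.toFun n ≤ (φ₀.comp ψ).toFun n := h'
  refine ⟨ψ, hψ, X.precompHom h'', ?_⟩
  refine (congrArg (fun t => Localization.Construction.wInv _ _ ≫ (Ua 𝓔).Q.map t)
    (X.precompHom_precompHom h hψ h'').symm).trans ?_
  refine (congrArg (fun t => Localization.Construction.wInv _ _ ≫ t)
    ((Ua 𝓔).Q.map_comp (X.precompHom h) (X.precompHom h''))).trans ?_
  exact (Localization.Construction.wIso (X.precompHom h) ⟨X, φ₀, φ₁, h⟩).inv_hom_id_assoc _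

variable (𝓔) in
/-- The class of fractions, for arbitrary objects of the localization. -/
def fractions : MorphismProperty (Beilinson 𝓔) := fun S T α =>
  IsFraction (X := (Localization.Construction.objEquiv (Ua 𝓔)).symm S)
    (Y := (Localization.Construction.objEquiv (Ua 𝓔)).symm T) α

instance : (fractions 𝓔).IsStableUnderComposition where
  comp_mem _ _ hf hg := IsFraction.comp hf hg

/-- The localization is generated under composition by images of maps and by formal inverses, and
all of these are fractions. -/
theorem isFraction {X Y : BiFunA 𝓔} (α : (Ua 𝓔).Q.obj X ⟶ (Ua 𝓔).Q.obj Y) : IsFraction α := by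
  have := Localization.Construction.morphismProperty_eq_top (fractions 𝓔)
    (fun _ _ f => isFraction_Q_map f) (fun _ _ w hw => isFraction_wInv w hw)
  have h : fractions 𝓔 α := by rw [this]; trivial
  exact h

theorem embedding_map_Q {X Y : BiFunA 𝓔} (f : X ⟶ Y) :
    (embedding 𝓔).map ((Ua 𝓔).Q.map f) = (biFunToKato 𝓔).map f := by
  have := Functor.congr_hom (Localization.Construction.fac (biFunToKato 𝓔)
    (biFunToKato_inverts 𝓔)) f
  exact this.trans ((Category.id_comp _).trans (Category.comp_id _))

theorem biFunToKato_map_injective {X Y : BiFunA 𝓔} {f g : X ⟶ Y}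
    (h : (biFunToKato 𝓔).map f = (biFunToKato 𝓔).map g) : f = g := by
  ext1
  exact isAdm.wedgeLim_map_injective X.property Y.property (congrArg (fun t => t.hom.hom) h)

theorem isIso_Q_toPrecomp (X : BiFunA 𝓔) (φ : Bicofinal) (h : ∀ n, n ≤ φ.toFun n) :
    IsIso ((Ua 𝓔).Q.map (X.toPrecomp φ h)) :=
  (Ua 𝓔).Q_inverts _ (X.toPrecomp_mem φ h)

/-- Over the common denominator given by `φ.sup ψ` both maps come from admissible functors, where
`biFunToKato` is already faithful; no Ore cancellation condition is needed. -/
theorem embedding_map_injective {X Y : BiFunA 𝓔} {α β : (Ua 𝓔).Q.obj X ⟶ (Ua 𝓔).Q.obj Y}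
    (e : (embedding 𝓔).map α = (embedding 𝓔).map β) : α = β := by
  obtain ⟨φ, hφ, g, hg⟩ := isFraction α
  obtain ⟨ψ, hψ, k, hk⟩ := isFraction β
  have h₁ : ∀ n, φ.toFun n ≤ (φ.sup ψ).toFun n := fun n => le_max_left _ _
  have h₂ : ∀ n, ψ.toFun n ≤ (φ.sup ψ).toFun n := fun n => le_max_right _ _
  have hs : ∀ n, n ≤ (φ.sup ψ).toFun n := fun n => (hφ n).trans (h₁ n)
  have e₁ : α ≫ (Ua 𝓔).Q.map (Y.toPrecomp _ hs) = (Ua 𝓔).Q.map (g ≫ Y.precompHom h₁) := by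
    rw [← BiFunA.toPrecomp_precompHom Y hφ h₁, Functor.map_comp, Functor.map_comp,
      ← Category.assoc, hg]
  have e₂ : β ≫ (Ua 𝓔).Q.map (Y.toPrecomp _ hs) = (Ua 𝓔).Q.map (k ≫ Y.precompHom h₂) := by
    rw [← BiFunA.toPrecomp_precompHom Y hψ h₂, Functor.map_comp, Functor.map_comp,
      ← Category.assoc, hk]
  have e₃ : g ≫ Y.precompHom h₁ = k ≫ Y.precompHom h₂ := by
    apply biFunToKato_map_injective
    rw [← embedding_map_Q, ← embedding_map_Q, ← e₁, ← e₂, Functor.map_comp, Functor.map_comp, e]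
  have := isIso_Q_toPrecomp Y _ hs
  exact (cancel_mono ((Ua 𝓔).Q.map (Y.toPrecomp _ hs))).1 (by rw [e₁, e₂, e₃])

theorem embedding_map_surjective {X Y : BiFunA 𝓔}
    (f : (embedding 𝓔).obj ((Ua 𝓔).Q.obj X) ⟶ (embedding 𝓔).obj ((Ua 𝓔).Q.obj Y)) :
    ∃ α, (embedding 𝓔).map α = f := by
  obtain ⟨φ, hφ, g, hg⟩ := isAdm.exists_fraction X.property Y.property f.hom.hom
  have := isIso_Q_toPrecomp Y _ hφ
  let g' : X ⟶ Y.precomp φ := ObjectProperty.homMk g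
  have e : (embedding 𝓔).map ((Ua 𝓔).Q.map g') =
      f ≫ (embedding 𝓔).map ((Ua 𝓔).Q.map (Y.toPrecomp φ hφ)) := by
    rw [embedding_map_Q, embedding_map_Q]
    apply ObjectProperty.hom_ext
    apply ObjectProperty.hom_ext
    exact hg
  refine ⟨(Ua 𝓔).Q.map g' ≫ inv ((Ua 𝓔).Q.map (Y.toPrecomp φ hφ)), ?_⟩
  rw [Functor.map_comp, e, Category.assoc, ← Functor.map_comp, IsIso.hom_inv_id,
    CategoryTheory.Functor.map_id, Category.comp_id]

instance : (embedding 𝓔).Faithful where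
  map_injective {S T} α β e := by
    obtain ⟨X, rfl⟩ := (Localization.Construction.objEquiv (Ua 𝓔)).surjective S
    obtain ⟨Y, rfl⟩ := (Localization.Construction.objEquiv (Ua 𝓔)).surjective T
    exact embedding_map_injective e

instance : (embedding 𝓔).Full where
  map_surjective {S T} f := by
    obtain ⟨X, rfl⟩ := (Localization.Construction.objEquiv (Ua 𝓔)).surjective S
    obtain ⟨Y, rfl⟩ := (Localization.Construction.objEquiv (Ua 𝓔)).surjective T
    exact embedding_map_surjective f

end Localization

/-! ### Consequences of the axioms of an exact structure. -/

section ExactLemmas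

variable {A : Type u} [Category.{v} A] [Preadditive A] [HasZeroObject A]
  [HasBinaryBiproducts A] (𝓔 : ExactStructure A)

theorem ExactStructure.mem_of_isCokernel {a b c : A} {f : a ⟶ b} {g : b ⟶ c} (w : f ≫ g = 0)
    (hf : IsAdmMono 𝓔.E f) (hg : IsColimit (CokernelCofork.ofπ g w)) :
    𝓔.E (ShortComplex.mk f g w) := by
  obtain ⟨c', g', w', h⟩ := hf
  obtain ⟨hg'⟩ := 𝓔.isCokernel _ h
  refine 𝓔.of_iso (ShortComplex.mk f g' w') (ShortComplex.mk f g w)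
    (ShortComplex.isoMk (Iso.refl _) (Iso.refl _) (hg'.coconePointUniqueUpToIso hg) (by simp) ?_) h
  have := hg'.comp_coconePointUniqueUpToIso_hom hg WalkingParallelPair.one
  dsimp at this ⊢
  rw [Category.id_comp]
  exact this.symm

theorem ExactStructure.mem_of_isKernel {a b c : A} {f : a ⟶ b} {g : b ⟶ c} (w : f ≫ g = 0)
    (hg : IsAdmEpi 𝓔.E g) (hf : IsLimit (KernelFork.ofι f w)) :
    𝓔.E (ShortComplex.mk f g w) := by
  obtain ⟨a', f', w', h⟩ := hg
  obtain ⟨hf'⟩ := 𝓔.isKernel _ h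
  refine 𝓔.of_iso (ShortComplex.mk f' g w') (ShortComplex.mk f g w)
    (ShortComplex.isoMk (hf'.conePointUniqueUpToIso hf) (Iso.refl _)
    (Iso.refl _) ?_ (by simp)) h
  have := hf'.conePointUniqueUpToIso_hom_comp hf WalkingParallelPair.zero
  dsimp at this ⊢
  rw [Category.comp_id]
  exact this

variable {𝓔}

theorem IsAdmMono.hasCokernel {a b : A} {f : a ⟶ b} (hf : IsAdmMono 𝓔.E f) : HasCokernel f := by
  obtain ⟨c, g, w, h⟩ := hf
  obtain ⟨k⟩ := 𝓔.isCokernel _ h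
  exact ⟨⟨⟨_, k⟩⟩⟩

theorem IsAdmEpi.hasKernel {a b : A} {f : a ⟶ b} (hf : IsAdmEpi 𝓔.E f) : HasKernel f := by
  obtain ⟨c, g, w, h⟩ := hf
  obtain ⟨k⟩ := 𝓔.isKernel _ h
  exact ⟨⟨⟨_, k⟩⟩⟩

theorem IsAdmMono.of_iso {a b a' b' : A} {f : a ⟶ b} {f' : a' ⟶ b'} (hf : IsAdmMono 𝓔.E f)
    (e₁ : a ≅ a') (e₂ : b ≅ b') (h : f ≫ e₂.hom = e₁.hom ≫ f') : IsAdmMono 𝓔.E f' := by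
  obtain ⟨c, g, w, hE⟩ := hf
  have w' : f' ≫ e₂.inv ≫ g = 0 := by
    rw [← cancel_epi e₁.hom, ← reassoc_of% h, Iso.hom_inv_id_assoc, w, comp_zero]
  exact ⟨c, e₂.inv ≫ g, w', 𝓔.of_iso (ShortComplex.mk f g w) (ShortComplex.mk f' _ w')
    (ShortComplex.isoMk e₁ e₂ (Iso.refl _) h.symm (by simp)) hE⟩

theorem IsAdmEpi.of_iso {a b a' b' : A} {f : a ⟶ b} {f' : a' ⟶ b'} (hf : IsAdmEpi 𝓔.E f)
    (e₁ : a ≅ a') (e₂ : b ≅ b') (h : f ≫ e₂.hom = e₁.hom ≫ f') : IsAdmEpi 𝓔.E f' := by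
  obtain ⟨c, g, w, hE⟩ := hf
  have w' : (g ≫ e₁.hom) ≫ f' = 0 := by
    rw [Category.assoc, ← h, reassoc_of% w, zero_comp]
  exact ⟨c, g ≫ e₁.hom, w', 𝓔.of_iso (ShortComplex.mk g f w) (ShortComplex.mk _ f' w')
    (ShortComplex.isoMk (Iso.refl _) e₁ e₂ (by simp) h.symm) hE⟩

theorem IsAdmMono.of_isPushout {a a' b b' : A} {i : a ⟶ a'} {f : a ⟶ b} {i' : b ⟶ b'}
    {f' : a' ⟶ b'} (hi : IsAdmMono 𝓔.E i) (h : IsPushout f i i' f') : IsAdmMono 𝓔.E i' := by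
  obtain ⟨c, i'', f'', h', hi''⟩ := 𝓔.exists_pushout i f hi
  exact hi''.of_iso (Iso.refl _) (h'.isoIsPushout _ _ h) (by simp)

theorem IsAdmEpi.of_isPullback {a' a'' b' b'' : A} {j : a' ⟶ a''} {f : b'' ⟶ a''} {j' : b' ⟶ b''}
    {f' : b' ⟶ a'} (hj : IsAdmEpi 𝓔.E j) (h : IsPullback j' f' f j) : IsAdmEpi 𝓔.E j' := by
  obtain ⟨c, j'', f'', h', hj''⟩ := 𝓔.exists_pullback j f hj
  exact hj''.of_iso (h'.isoIsPullback _ _ h) (Iso.refl _) (by simp)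

-- If `a` is zero, the split sequence has middle term `a ⊞ b ≅ b`.
variable (𝓔) in
theorem isAdmMono_of_isZero {a b : A} (ha : IsZero a) (f : a ⟶ b) : IsAdmMono 𝓔.E f := by
  refine IsAdmMono.of_iso ⟨_, _, _, 𝓔.split a b⟩ (Iso.refl a)
    ⟨biprod.snd, biprod.inr, ?_, ?_⟩ (ha.eq_of_src _ _)
  · rw [← biprod.total, ha.eq_zero_of_src (biprod.inl : a ⟶ a ⊞ b), comp_zero, zero_add]
  · simp

variable (𝓔) in
theorem isAdmEpi_of_isZero {a b : A} (hb : IsZero b) (f : a ⟶ b) : IsAdmEpi 𝓔.E f := by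
  refine IsAdmEpi.of_iso ⟨_, _, _, 𝓔.split a b⟩ ⟨biprod.fst, biprod.inl, ?_, ?_⟩ (Iso.refl b)
    (hb.eq_of_tgt _ _)
  · rw [← biprod.total, hb.eq_zero_of_src (biprod.inr : b ⟶ a ⊞ b), comp_zero, add_zero]
  · simp

end ExactLemmas

/-! ### Criteria for limits and colimits by existence alone. -/

section UniversalProperties

variable {A : Type u} [Category.{v} A]

/-- Uniqueness follows from `Mono snd`, compatibility with `fst` from `Mono f`. -/
theorem isPullback_of_exists_lift {P X Y Z : A} {fst : P ⟶ X} {snd : P ⟶ Y} {f : X ⟶ Z} {g : Y ⟶ Z}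
    (comm : fst ≫ f = snd ≫ g) [Mono snd] [Mono f]
    (h : ∀ {T : A} (a : T ⟶ X) (b : T ⟶ Y), a ≫ f = b ≫ g → ∃ l, l ≫ snd = b) :
    IsPullback fst snd f g := by
  choose l hl using fun c : PullbackCone f g => h c.fst c.snd c.condition
  refine ⟨⟨comm⟩, ⟨PullbackCone.IsLimit.mk comm l (fun c => ?_) hl (fun c m _ h₂ => ?_)⟩⟩
  · rw [← cancel_mono f, Category.assoc, comm, reassoc_of% hl, c.condition]
  · rw [← cancel_mono snd, h₂, hl]

theorem isPushout_of_exists_desc {Z X Y P : A} {f : Z ⟶ X} {g : Z ⟶ Y} {inl : X ⟶ P} {inr : Y ⟶ P}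
    (comm : f ≫ inl = g ≫ inr) [Epi inr] [Epi f]
    (h : ∀ {T : A} (a : X ⟶ T) (b : Y ⟶ T), f ≫ a = g ≫ b → ∃ l, inr ≫ l = b) :
    IsPushout f g inl inr := by
  choose l hl using fun c : PushoutCocone f g => h c.inl c.inr c.condition
  refine ⟨⟨comm⟩, ⟨PushoutCocone.IsColimit.mk comm l (fun c => ?_) hl (fun c m _ h₂ => ?_)⟩⟩
  · rw [← cancel_epi f, reassoc_of% comm, hl, c.condition]
  · rw [← cancel_epi inr, h₂, hl]

variable [HasZeroMorphisms A]

theorem isKernel_of_exists_lift {a b c : A} {f : a ⟶ b} {g : b ⟶ c} (w : f ≫ g = 0) [Mono f]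
    (h : ∀ {T : A} (t : T ⟶ b), t ≫ g = 0 → ∃ l, l ≫ f = t) :
    Nonempty (IsLimit (KernelFork.ofι f w)) :=
  ⟨KernelFork.IsLimit.ofι' f w fun t ht => ⟨(h t ht).choose, (h t ht).choose_spec⟩⟩

theorem isCokernel_of_exists_desc {a b c : A} {f : a ⟶ b} {g : b ⟶ c} (w : f ≫ g = 0) [Epi g]
    (h : ∀ {T : A} (t : b ⟶ T), f ≫ t = 0 → ∃ l, g ≫ l = t) :
    Nonempty (IsColimit (CokernelCofork.ofπ g w)) :=
  ⟨CokernelCofork.IsColimit.ofπ' g w fun t ht => ⟨(h t ht).choose, (h t ht).choose_spec⟩⟩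

end UniversalProperties

/-! ### Pointwise kernels and cokernels of transformations. -/

section KerCoker

variable {J : Type*} [Category* J] {A : Type u} [Category.{v} A] [HasZeroMorphisms A]
  {S T : J ⥤ A} (α : S ⟶ T)

section Ker

variable [∀ p, HasKernel (α.app p)]

/-- The pointwise kernel of a transformation. -/
def kerFunctor : J ⥤ A where
  obj p := kernel (α.app p)
  map {p q} f := kernel.map (α.app p) (α.app q) (S.map f) (T.map f) (α.naturality f).symm
  map_id p := by ext; simp
  map_comp f g := by ext; simp

/-- The inclusion of the pointwise kernel. -/
def kerFunctorι : kerFunctor α ⟶ S where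
  app p := kernel.ι (α.app p)
  naturality p q f := by simp [kerFunctor]

instance (p : J) : Mono ((kerFunctorι α).app p) :=
  inferInstanceAs (Mono (kernel.ι (α.app p)))

theorem kerFunctorι_app_comp (p : J) : (kerFunctorι α).app p ≫ α.app p = 0 :=
  kernel.condition _

theorem exists_kerFunctor_lift {p : J} {X : A} (t : X ⟶ S.obj p) (ht : t ≫ α.app p = 0) :
    ∃ l : X ⟶ (kerFunctor α).obj p, l ≫ (kerFunctorι α).app p = t :=
  ⟨kernel.lift _ t ht, kernel.lift_ι _ _ _⟩

/-- As `T.map f` is mono, an element of `S_p` lies in the kernel once its image in `S_q` does.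
Through this square, admissible epimorphisms pass from `S` to the kernels. -/
theorem isPullback_kerFunctor {p q : J} (f : p ⟶ q) [Mono (T.map f)] :
    IsPullback ((kerFunctor α).map f) ((kerFunctorι α).app p) ((kerFunctorι α).app q)
      (S.map f) := by
  refine isPullback_of_exists_lift ((kerFunctorι α).naturality f) fun a b h => ?_
  apply exists_kerFunctor_lift
  rw [← cancel_mono (T.map f), Category.assoc, ← α.naturality, ← reassoc_of% h,
    kerFunctorι_app_comp, comp_zero, zero_comp]

end Ker

section Coker

variable [∀ p, HasCokernel (α.app p)]

/-- The pointwise cokernel of a transformation. -/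
def cokerFunctor : J ⥤ A where
  obj p := cokernel (α.app p)
  map {p q} f := cokernel.map (α.app p) (α.app q) (S.map f) (T.map f) (α.naturality f).symm
  map_id p := by ext; simp
  map_comp f g := by ext; simp

/-- The projection to the pointwise cokernel. -/
def cokerFunctorπ : T ⟶ cokerFunctor α where
  app p := cokernel.π (α.app p)
  naturality p q f := by simp [cokerFunctor]

instance (p : J) : Epi ((cokerFunctorπ α).app p) :=
  inferInstanceAs (Epi (cokernel.π (α.app p)))

theorem comp_cokerFunctorπ_app (p : J) : α.app p ≫ (cokerFunctorπ α).app p = 0 :=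
  cokernel.condition _

theorem exists_cokerFunctor_desc {p : J} {X : A} (t : T.obj p ⟶ X) (ht : α.app p ≫ t = 0) :
    ∃ l : (cokerFunctor α).obj p ⟶ X, (cokerFunctorπ α).app p ≫ l = t :=
  ⟨cokernel.desc _ t ht, cokernel.π_desc _ _ _⟩

end Coker

end KerCoker

/-! ### Extension of a bifunctor from a quadrant to an admissible functor on `Wedge`. -/

section Grid

variable {A : Type u} [Category.{v} A]

/-- The map `V_{n,i} ⟶ V_{n',i'}` of a bifunctor on `ℕ × ℤ`. -/
def gridMap (V : ℕ ⥤ ℤ ⥤ A) {n n' : ℕ} {i i' : ℤ} (hn : n ≤ n') (hi : i ≤ i') :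
    (V.obj n).obj i ⟶ (V.obj n').obj i' :=
  (V.map (homOfLE hn)).app i ≫ (V.obj n').map (homOfLE hi)

theorem gridMap_comp (V : ℕ ⥤ ℤ ⥤ A) {n n' n'' : ℕ} {i i' i'' : ℤ} (hn : n ≤ n') (hi : i ≤ i')
    (hn' : n' ≤ n'') (hi' : i' ≤ i'') :
    gridMap V hn hi ≫ gridMap V hn' hi' = gridMap V (hn.trans hn') (hi.trans hi') := by
  have e₁ := Functor.map_comp V (homOfLE hn) (homOfLE hn')
  have e₂ := Functor.map_comp (V.obj n'') (homOfLE hi) (homOfLE hi')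
  rw [homOfLE_comp] at e₁ e₂
  simp only [gridMap, e₁, e₂, NatTrans.comp_app, Category.assoc, NatTrans.naturality_assoc]

theorem gridMap_refl (V : ℕ ⥤ ℤ ⥤ A) {n : ℕ} {i : ℤ} (hn : n ≤ n) (hi : i ≤ i) :
    gridMap V hn hi = 𝟙 _ := by
  have e₁ : V.map (homOfLE hn) = 𝟙 _ := V.map_id n
  have e₂ : (V.obj n).map (homOfLE hi) = 𝟙 _ := (V.obj n).map_id i
  rw [gridMap, e₁, e₂, NatTrans.id_app, Category.comp_id]

theorem isIso_gridMap_refl (V : ℕ ⥤ ℤ ⥤ A) {n : ℕ} {i : ℤ} (hn : n ≤ n) (hi : i ≤ i) :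
    IsIso (gridMap V hn hi) := by
  rw [gridMap_refl]
  infer_instance

/-- The functor `(i, j) ↦ V_{max j 0, i}`. -/
def gridSrc (V : ℕ ⥤ ℤ ⥤ A) : Wedge ⥤ A where
  obj p := (V.obj p.1.2.toNat).obj p.1.1
  map f := gridMap V (Int.toNat_le_toNat f.le.2) f.le.1
  map_id _ := gridMap_refl V _ _
  map_comp _ _ := (gridMap_comp V _ _ _ _).symm

/-- The functor `(i, j) ↦ V_{max j 0, j}`. -/
def gridTgt (V : ℕ ⥤ ℤ ⥤ A) : Wedge ⥤ A where
  obj p := (V.obj p.1.2.toNat).obj p.1.2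
  map f := gridMap V (Int.toNat_le_toNat f.le.2) f.le.2
  map_id _ := gridMap_refl V _ _
  map_comp _ _ := (gridMap_comp V _ _ _ _).symm

/-- The transformation whose kernel is `gridKer`. -/
def gridHom (V : ℕ ⥤ ℤ ⥤ A) : gridSrc V ⟶ gridTgt V where
  app p := gridMap V le_rfl p.2
  naturality _ _ _ := (gridMap_comp V _ _ _ _).trans (gridMap_comp V _ _ _ _).symm

variable [Preadditive A]

section Ker

variable (V : ℕ ⥤ ℤ ⥤ A) [∀ p, HasKernel ((gridHom V).app p)]

/-- The functor `(i, j) ↦ ker (V_{max j 0, i} ⟶ V_{max j 0, j})`. -/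
abbrev gridKer : Wedge ⥤ A := kerFunctor (gridHom V)

/-- The inclusion of `gridKer`. -/
abbrev gridKerι : gridKer V ⟶ gridSrc V := kerFunctorι (gridHom V)

theorem gridKer_isZero {i j : ℤ} (hij : i ≤ j) (h : i = j) :
    IsZero ((gridKer V).obj (Wedge.mk i j hij)) := by
  subst h
  have h : IsIso ((gridHom V).app (Wedge.mk i i hij)) := isIso_gridMap_refl V _ _
  have e := kerFunctorι_app_comp (gridHom V) (Wedge.mk i i hij)
  rw [← zero_comp, cancel_mono] at e
  rw [IsZero.iff_id_eq_zero, ← cancel_mono ((gridKerι V).app (Wedge.mk i i hij)), e, comp_zero,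
    comp_zero]

end Ker

section Coker

/-- The endofunctor `(i, j) ↦ (min i (-1), i)` of `Wedge`. -/
def wedgeLow : Wedge ⥤ Wedge :=
  Monotone.functor (f := fun p : Wedge => Wedge.mk (min p.1.1 (-1)) p.1.1 (min_le_left _ _))
    (fun _ _ h => ⟨min_le_min h.1 le_rfl, h.1⟩)

/-- The endofunctor `(i, j) ↦ (min i (-1), j)` of `Wedge`. -/
def wedgeUp : Wedge ⥤ Wedge :=
  Monotone.functor
    (f := fun p : Wedge => Wedge.mk (min p.1.1 (-1)) p.1.2 ((min_le_left _ _).trans p.2))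
    (fun _ _ h => ⟨min_le_min h.1 le_rfl, h.2⟩)

/-- The transformation `(min i (-1), i) ⟶ (min i (-1), j)`. -/
def wedgeLowUp : wedgeLow ⟶ wedgeUp where
  app p := Wedge.hom (min_le_left _ _) ((min_le_left _ _).trans p.2) le_rfl p.2
  naturality _ _ _ := Subsingleton.elim _ _

variable (K : Wedge ⥤ A)

/-- The transformation `K_{min i (-1), i} ⟶ K_{min i (-1), j}`. -/
abbrev lowUp : wedgeLow ⋙ K ⟶ wedgeUp ⋙ K := Functor.whiskerRight wedgeLowUp K

variable [∀ p, HasCokernel ((lowUp K).app p)]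

/-- The functor `(i, j) ↦ coker (K_{min i (-1), i} ⟶ K_{min i (-1), j})`. -/
abbrev wedgeExt : Wedge ⥤ A := cokerFunctor (lowUp K)

theorem min_neg_le {i j : ℤ} (h : i ≤ j) : min i (-1) ≤ j := (min_le_left _ _).trans h

/-- The projection to `wedgeExt`. -/
def wedgeExtπ {i j : ℤ} (h : i ≤ j) :
    K.obj (Wedge.mk (min i (-1)) j (min_neg_le h)) ⟶ (wedgeExt K).obj (Wedge.mk i j h) :=
  (cokerFunctorπ (lowUp K)).app (Wedge.mk i j h)

instance {i j : ℤ} (h : i ≤ j) : Epi (wedgeExtπ K h) :=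
  inferInstanceAs (Epi ((cokerFunctorπ (lowUp K)).app (Wedge.mk i j h)))

theorem wedgeExtπ_map {i j i' j' : ℤ} (h : i ≤ j) (h' : i' ≤ j') (hi : i ≤ i') (hj : j ≤ j') :
    wedgeExtπ K h ≫ (wedgeExt K).map (Wedge.hom h h' hi hj) =
      K.map (Wedge.hom (min_neg_le h) (min_neg_le h') (min_le_min hi le_rfl) hj) ≫
        wedgeExtπ K h' :=
  ((cokerFunctorπ (lowUp K)).naturality _).symm

theorem map_wedgeExtπ {i j : ℤ} (h : i ≤ j) :
    K.map (Wedge.hom (min_neg_le le_rfl) (min_neg_le h) le_rfl h) ≫ wedgeExtπ K h = 0 :=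
  comp_cokerFunctorπ_app (lowUp K) (Wedge.mk i j h)

theorem exists_wedgeExt_desc {i j : ℤ} (h : i ≤ j) {T : A}
    (t : K.obj (Wedge.mk (min i (-1)) j (min_neg_le h)) ⟶ T)
    (ht : K.map (Wedge.hom (min_neg_le le_rfl) (min_neg_le h) le_rfl h) ≫ t = 0) :
    ∃ l : (wedgeExt K).obj (Wedge.mk i j h) ⟶ T, wedgeExtπ K h ≫ l = t :=
  exists_cokerFunctor_desc (lowUp K) (p := Wedge.mk i j h) t ht

/-- For negative `i` the map whose cokernel is taken factors through `K_{i,i} = 0`, so nothing is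
divided out. -/
theorem isIso_wedgeExtπ (hK : ∀ i, IsZero (K.obj (Wedge.mk i i le_rfl))) {i j : ℤ} (h : i ≤ j)
    (hi : i < 0) : IsIso (wedgeExtπ K h) := by
  have hi' : i ≤ min i (-1) := le_min le_rfl (by omega)
  have e : K.map (Wedge.hom (min_neg_le le_rfl) (min_neg_le h) le_rfl h) = 0 := by
    rw [← wedge_map_comp K (Wedge.hom (min_neg_le le_rfl) le_rfl (min_le_left i (-1)) le_rfl)
      (Wedge.hom le_rfl (min_neg_le h) hi' h), (hK i).eq_zero_of_tgt (K.map _), zero_comp]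
  obtain ⟨l, hl⟩ := exists_wedgeExt_desc K h (𝟙 _) (by rw [e, zero_comp])
  refine ⟨l, hl, ?_⟩
  rw [← cancel_epi (wedgeExtπ K h), reassoc_of% hl, Category.comp_id]

end Coker

variable [HasZeroObject A] [HasBinaryBiproducts A]

/-- The conditions on a bifunctor on `ℕ × ℤ` under which it is, at negative integers, part of an
admissible functor `Wedge ⥤ A`. -/
structure IsGrid (𝓔 : ExactStructure A) (V : ℕ ⥤ ℤ ⥤ A) : Prop where
  admEpi : ∀ (n : ℕ) {i i' : ℤ} (hi : i ≤ i'), IsAdmEpi 𝓔.E (gridMap V (le_refl n) hi)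
  admMono : ∀ {n n' : ℕ} (hn : n ≤ n') (i : ℤ), IsAdmMono 𝓔.E (gridMap V hn (le_refl i))
  isPullback : ∀ {n n' : ℕ} (hn : n ≤ n') {i i' : ℤ} (hi : i ≤ i') (_ : i' < 0),
    IsPullback (gridMap V hn (le_refl i)) (gridMap V (le_refl n) hi) (gridMap V (le_refl n') hi)
      (gridMap V hn (le_refl i'))
  isZero : ∀ (n : ℕ) {i : ℤ} (_ : 0 ≤ i), IsZero ((V.obj n).obj i)

variable {𝓔 : ExactStructure A} {V : ℕ ⥤ ℤ ⥤ A}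

theorem IsGrid.hasKernel (hV : IsGrid 𝓔 V) (p : Wedge) : HasKernel ((gridHom V).app p) :=
  (hV.admEpi _ p.2).hasKernel

variable [∀ p, HasKernel ((gridHom V).app p)]

theorem IsGrid.isIso_gridKerι (hV : IsGrid 𝓔 V) (p : Wedge) (hp : 0 ≤ p.1.2) :
    IsIso ((gridKerι V).app p) := by
  have h : (gridHom V).app p = 0 := (hV.isZero p.1.2.toNat hp).eq_of_tgt _ _
  obtain ⟨l, hl⟩ := exists_kerFunctor_lift (gridHom V) (p := p) (𝟙 _) (by rw [h, comp_zero])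
  refine ⟨l, ?_, hl⟩
  rw [← cancel_mono ((gridKerι V).app p), Category.assoc, hl, Category.comp_id, Category.id_comp]

theorem IsGrid.gridKer_admMono (hV : IsGrid 𝓔 V) {i j k : ℤ} (hij : i ≤ j) (hjk : j ≤ k)
    (hj : 0 ≤ j) :
    IsAdmMono 𝓔.E ((gridKer V).map (Wedge.hom hij (hij.trans hjk) le_rfl hjk)) := by
  have := hV.isIso_gridKerι (Wedge.mk i j hij) hj
  have := hV.isIso_gridKerι (Wedge.mk i k (hij.trans hjk)) (hj.trans hjk)
  have h : IsAdmMono 𝓔.E ((gridSrc V).map (Wedge.hom hij (hij.trans hjk) le_rfl hjk)) :=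
    hV.admMono _ _
  refine h.of_iso (asIso ((gridKerι V).app _)).symm (asIso ((gridKerι V).app _)).symm ?_
  simp

/-- The second map is a pullback of `V_{max k 0, i} ⟶ V_{max k 0, j}`, hence an admissible
epimorphism. Its kernel is identified by the cartesian square, which lifts a map killed in `V_{max k
0, j}` to `V_{0,i}`, with zero image in `V_{0,j}`. The copy `m` of `j` is there for use with `min j
(-1)`. -/
theorem IsGrid.gridKer_mem (hV : IsGrid 𝓔 V) {i j m k : ℤ} (hij : i ≤ j) (hjk : j ≤ k)
    (hj : j < 0) (hm : m = j) :
    ∃ w : (gridKer V).map (Wedge.hom hij (hij.trans hjk) le_rfl hjk) ≫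
        (gridKer V).map (Wedge.hom (hij.trans hjk) (hm.le.trans hjk) (hij.trans hm.ge) le_rfl) = 0,
      𝓔.E (ShortComplex.mk _ _ w) := by
  subst hm
  have w : (gridKer V).map (Wedge.hom hij (hij.trans hjk) le_rfl hjk) ≫
      (gridKer V).map (Wedge.hom (hij.trans hjk) hjk hij le_rfl) = 0 := by
    rw [wedge_comp (gridKer V) _ _ (Wedge.hom hij le_rfl hij le_rfl)
      (Wedge.hom le_rfl hjk le_rfl hjk),
      (gridKer_isZero V le_rfl rfl).eq_zero_of_src ((gridKer V).map (Wedge.hom le_rfl hjk _ _)),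
      comp_zero]
  have hm₁ : Mono ((gridSrc V).map (Wedge.hom hij (hij.trans hjk) le_rfl hjk)) :=
    (hV.admMono _ _).mono
  have hm₂ : Mono ((gridKer V).map (Wedge.hom hij (hij.trans hjk) le_rfl hjk)) := by
    have : Mono ((gridKer V).map (Wedge.hom hij (hij.trans hjk) le_rfl hjk) ≫
        (gridKerι V).app _) := by
      rw [(gridKerι V).naturality]
      infer_instance
    exact mono_of_mono _ ((gridKerι V).app _)
  have hm₃ : IsIso ((gridTgt V).map (Wedge.hom (hij.trans hjk) hjk hij le_rfl)) :=
    isIso_gridMap_refl V _ _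
  have hs : IsAdmEpi 𝓔.E ((gridSrc V).map (Wedge.hom (hij.trans hjk) hjk hij le_rfl)) :=
    hV.admEpi _ _
  have hpb := hV.isPullback (Int.toNat_le_toNat hjk) hij hj
  obtain ⟨hk⟩ := isKernel_of_exists_lift w fun {T} t ht => by
    have e₁ : (t ≫ (gridKerι V).app _) ≫
        (gridSrc V).map (Wedge.hom (hij.trans hjk) hjk hij le_rfl) = 0 := by
      rw [Category.assoc, ← (gridKerι V).naturality, reassoc_of% ht, zero_comp]
    obtain ⟨s, hs₁, hs₂⟩ := hpb.exists_lift (t ≫ (gridKerι V).app _) 0 (e₁.trans zero_comp.symm)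
    obtain ⟨s', hs'⟩ := exists_kerFunctor_lift (gridHom V) (p := Wedge.mk i m hij) s hs₂
    refine ⟨s', ?_⟩
    rw [← cancel_mono ((gridKerι V).app _), Category.assoc, (gridKerι V).naturality,
      reassoc_of% hs']
    exact hs₁
  exact ⟨w, 𝓔.mem_of_isKernel w (hs.of_isPullback (isPullback_kerFunctor _ _)) hk⟩

theorem IsGrid.lowUp_admMono (hV : IsGrid 𝓔 V) (p : Wedge) :
    IsAdmMono 𝓔.E ((lowUp (gridKer V)).app p) := by
  by_cases hp : p.1.1 < 0
  · exact isAdmMono_of_isZero 𝓔 (gridKer_isZero V (min_le_left _ _) (by omega)) _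
  · exact hV.gridKer_admMono (min_le_left _ _) p.2 (by omega)

theorem IsGrid.hasCokernel (hV : IsGrid 𝓔 V) (p : Wedge) :
    HasCokernel ((lowUp (gridKer V)).app p) :=
  (hV.lowUp_admMono p).hasCokernel

variable [∀ p, HasCokernel ((lowUp (gridKer V)).app p)]

theorem IsGrid.isAdm_of_neg (hV : IsGrid 𝓔 V) {i j k : ℤ} (hij : i ≤ j) (hjk : j ≤ k)
    (hj : j < 0) :
    ∃ w : (wedgeExt (gridKer V)).map (Wedge.hom hij (hij.trans hjk) le_rfl hjk) ≫
        (wedgeExt (gridKer V)).map (Wedge.hom (hij.trans hjk) hjk hij le_rfl) = 0,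
      𝓔.E (ShortComplex.mk _ _ w) := by
  have hz : ∀ i, IsZero ((gridKer V).obj (Wedge.mk i i le_rfl)) :=
    fun i => gridKer_isZero V le_rfl rfl
  have h₁ := isIso_wedgeExtπ (gridKer V) hz hij (by omega)
  have h₂ := isIso_wedgeExtπ (gridKer V) hz (hij.trans hjk) (by omega)
  have h₃ := isIso_wedgeExtπ (gridKer V) hz hjk hj
  obtain ⟨w, hw⟩ := hV.gridKer_mem (i := min i (-1)) (j := j) (m := min j (-1)) (k := k)
    (by omega) hjk hj (by omega)
  have e₁ := wedgeExtπ_map (gridKer V) hij (hij.trans hjk) le_rfl hjk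
  have e₂ := wedgeExtπ_map (gridKer V) (hij.trans hjk) hjk hij le_rfl
  have w' : (wedgeExt (gridKer V)).map (Wedge.hom hij (hij.trans hjk) le_rfl hjk) ≫
      (wedgeExt (gridKer V)).map (Wedge.hom (hij.trans hjk) hjk hij le_rfl) = 0 := by
    rw [← cancel_epi (wedgeExtπ (gridKer V) hij), reassoc_of% e₁, e₂, reassoc_of% w, zero_comp,
      comp_zero]
  exact ⟨w', 𝓔.of_iso (ShortComplex.mk _ _ w) (ShortComplex.mk _ _ w')
    (ShortComplex.isoMk (asIso (wedgeExtπ (gridKer V) hij))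
      (asIso (wedgeExtπ (gridKer V) (hij.trans hjk)))
      (asIso (wedgeExtπ (gridKer V) hjk)) e₁ e₂) hw⟩

/-- With `K = gridKer V`, `i' = min i (-1)` and `j' = min j (-1)`, the first map is a pushout of the
admissible monomorphism `K_{i',j} ⟶ K_{i',k}`, and its cokernel is found by the Noether isomorphism
`K_{i',k} / K_{i',j} ≅ K_{j',k} / K_{j',j}`. -/
theorem IsGrid.isAdm_of_nonneg (hV : IsGrid 𝓔 V) {i j k : ℤ} (hij : i ≤ j) (hjk : j ≤ k)
    (hj : 0 ≤ j) :
    ∃ w : (wedgeExt (gridKer V)).map (Wedge.hom hij (hij.trans hjk) le_rfl hjk) ≫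
        (wedgeExt (gridKer V)).map (Wedge.hom (hij.trans hjk) hjk hij le_rfl) = 0,
      𝓔.E (ShortComplex.mk _ _ w) := by
  have hik := hij.trans hjk
  have e₁ := wedgeExtπ_map (gridKer V) hij hik le_rfl hjk
  have e₂ := wedgeExtπ_map (gridKer V) hik hjk hij le_rfl
  have hmj : min j (-1) < 0 := by omega
  have hmi : min i (-1) ≤ min j (-1) := min_le_min hij le_rfl
  have hmjj : min j (-1) ≤ j := min_le_left _ _
  have hmjk : min j (-1) ≤ k := hmjj.trans hjk
  have hf := hV.gridKer_admMono (min_neg_le hij) hjk hj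
  obtain ⟨w₁, hw₁⟩ := hV.gridKer_mem hmi hmjk hmj rfl
  obtain ⟨w₂, hw₂⟩ := hV.gridKer_mem hmi hmjj hmj rfl
  have hg : Epi ((gridKer V).map (Wedge.hom (hmi.trans hmjk) hmjk hmi le_rfl)) :=
    IsAdmEpi.epi (𝓔 := 𝓔) ⟨_, _, w₁, hw₁⟩
  have ha : Epi ((gridKer V).map (Wedge.hom (hmi.trans hmjj) hmjj hmi le_rfl)) :=
    IsAdmEpi.epi (𝓔 := 𝓔) ⟨_, _, w₂, hw₂⟩
  have hsq := wedge_comp (gridKer V) (Wedge.hom (min_neg_le hij) (min_neg_le hik) le_rfl hjk)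
    (Wedge.hom (min_neg_le hik) (min_neg_le hjk) hmi le_rfl)
    (Wedge.hom (min_neg_le hij) (min_neg_le le_rfl) hmi le_rfl)
    (Wedge.hom (min_neg_le le_rfl) (min_neg_le hjk) le_rfl hjk)
  -- A map killing `K_{i',j}` kills `K_{i',j'}`, so it factors through `K_{j',k}`; the factor kills
  -- `K_{j',j}` because `K_{i',j} ⟶ K_{j',j}` is epi.
  have hdesc : ∀ {T : A} (t : (gridKer V).obj (Wedge.mk (min i (-1)) k (min_neg_le hik)) ⟶ T),
      (gridKer V).map (Wedge.hom (min_neg_le hij) (min_neg_le hik) le_rfl hjk) ≫ t = 0 →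
        ∃ l, (gridKer V).map (Wedge.hom (min_neg_le hik) (min_neg_le hjk) hmi le_rfl) ≫
          wedgeExtπ (gridKer V) hjk ≫ l = t := by
    intro T t ht
    obtain ⟨c⟩ := 𝓔.isCokernel _ hw₁
    have hn : (gridKer V).map (Wedge.hom hmi (hmi.trans hmjk) le_rfl hmjk) ≫ t = 0 := by
      rw [← wedge_map_comp (gridKer V) (Wedge.hom hmi (min_neg_le hij) le_rfl hmjj)
        (Wedge.hom (min_neg_le hij) (min_neg_le hik) le_rfl hjk), Category.assoc, ht, comp_zero]
    let t' : (gridKer V).obj (Wedge.mk (min j (-1)) k (min_neg_le hjk)) ⟶ T :=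
      c.desc (CokernelCofork.ofπ t hn)
    have ht' : (gridKer V).map (Wedge.hom (min_neg_le hik) (min_neg_le hjk) hmi le_rfl) ≫ t' = t :=
      c.fac (CokernelCofork.ofπ t hn) WalkingParallelPair.one
    obtain ⟨l, hl⟩ := exists_wedgeExt_desc (gridKer V) hjk t' (by
      rw [← cancel_epi ((gridKer V).map (Wedge.hom (hmi.trans hmjj) hmjj hmi le_rfl)),
        ← reassoc_of% hsq, ht', ht, comp_zero])
    exact ⟨l, by rw [hl, ht']⟩
  have hpo : IsPushout (wedgeExtπ (gridKer V) hij)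
      ((gridKer V).map (Wedge.hom (min_neg_le hij) (min_neg_le hik) le_rfl hjk))
      ((wedgeExt (gridKer V)).map (Wedge.hom hij hik le_rfl hjk)) (wedgeExtπ (gridKer V) hik) := by
    refine isPushout_of_exists_desc e₁ fun a b h => ?_
    apply exists_wedgeExt_desc (gridKer V) hik
    rw [← wedge_map_comp (gridKer V)
      (Wedge.hom (min_neg_le le_rfl) (min_neg_le hij) le_rfl hij)
      (Wedge.hom (min_neg_le hij) (min_neg_le hik) le_rfl hjk), Category.assoc, ← h,
      reassoc_of% map_wedgeExtπ (gridKer V) hij, zero_comp]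
  have w : (wedgeExt (gridKer V)).map (Wedge.hom hij hik le_rfl hjk) ≫
      (wedgeExt (gridKer V)).map (Wedge.hom hik hjk hij le_rfl) = 0 := by
    rw [← cancel_epi (wedgeExtπ (gridKer V) hij), reassoc_of% e₁, e₂, reassoc_of% hsq,
      map_wedgeExtπ, comp_zero, comp_zero]
  have hWg : Epi ((wedgeExt (gridKer V)).map (Wedge.hom hik hjk hij le_rfl)) := by
    have : Epi (wedgeExtπ (gridKer V) hik ≫
        (wedgeExt (gridKer V)).map (Wedge.hom hik hjk hij le_rfl)) := by
      rw [e₂]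
      infer_instance
    exact epi_of_epi (wedgeExtπ (gridKer V) hik) _
  obtain ⟨hc⟩ := isCokernel_of_exists_desc w fun {T} t ht => by
    obtain ⟨l, hl⟩ := hdesc (wedgeExtπ (gridKer V) hik ≫ t)
      (by rw [← reassoc_of% e₁, ht, comp_zero])
    refine ⟨l, ?_⟩
    rw [← cancel_epi (wedgeExtπ (gridKer V) hik), ← hl, reassoc_of% e₂]
  exact ⟨w, 𝓔.mem_of_isCokernel w (hf.of_isPushout hpo) hc⟩

theorem IsGrid.isAdm_wedgeExt (hV : IsGrid 𝓔 V) : isAdm 𝓔 (wedgeExt (gridKer V)) :=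
  fun _ j _ hij hjk => (lt_or_ge j 0).elim (hV.isAdm_of_neg hij hjk) (hV.isAdm_of_nonneg hij hjk)

/-- At the pairs `(i, j)` with `i < 0 ≤ j` the extension is the bifunctor one starts from. -/
theorem IsGrid.exists_iso (hV : IsGrid 𝓔 V) :
    ∃ θ : ∀ p : Wedge, p.1.1 < 0 → 0 ≤ p.1.2 →
        ((wedgeExt (gridKer V)).obj p ≅ (gridSrc V).obj p),
      ∀ (p q : Wedge) (f : p ⟶ q) (hp : p.1.1 < 0) (hp' : 0 ≤ p.1.2) (hq : q.1.1 < 0)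
        (hq' : 0 ≤ q.1.2),
        (wedgeExt (gridKer V)).map f ≫ (θ q hq hq').hom = (θ p hp hp').hom ≫ (gridSrc V).map f := by
  have hz : ∀ i, IsZero ((gridKer V).obj (Wedge.mk i i le_rfl)) :=
    fun i => gridKer_isZero V le_rfl rfl
  have key : ∀ p : Wedge, p.1.1 < 0 → 0 ≤ p.1.2 →
      ∃ θ : (wedgeExt (gridKer V)).obj p ≅ (gridSrc V).obj p,
        wedgeExtπ (gridKer V) p.2 ≫ θ.hom =
          (gridKer V).map (Wedge.hom (min_neg_le p.2) p.2 (min_le_left _ _) le_rfl) ≫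
            (gridKerι V).app p := by
    intro p hp hp'
    have h₁ := isIso_wedgeExtπ (gridKer V) hz p.2 hp
    have h₂ := hV.isIso_gridKerι p hp'
    have h₃ : p.1.1 ≤ min p.1.1 (-1) := le_min le_rfl (by omega)
    let e : Wedge.mk (min p.1.1 (-1)) p.1.2 (min_neg_le p.2) ≅ Wedge.mk p.1.1 p.1.2 p.2 :=
      ⟨Wedge.hom (min_neg_le p.2) p.2 (min_le_left _ _) le_rfl,
        Wedge.hom p.2 (min_neg_le p.2) h₃ le_rfl, Subsingleton.elim _ _, Subsingleton.elim _ _⟩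
    exact ⟨(asIso (wedgeExtπ (gridKer V) p.2)).symm ≪≫ (gridKer V).mapIso e ≪≫
        asIso ((gridKerι V).app p), (asIso (wedgeExtπ (gridKer V) p.2)).hom_inv_id_assoc _⟩
  choose θ hθ using key
  refine ⟨θ, fun p q f hp hp' hq hq' => ?_⟩
  have e₁ := wedgeExtπ_map (gridKer V) p.2 q.2 f.le.1 f.le.2
  have e₂ := (gridKerι V).naturality f
  have e₃ := wedge_comp (gridKer V)
    (Wedge.hom (min_neg_le p.2) p.2 (min_le_left _ _) le_rfl) f
    (Wedge.hom (min_neg_le p.2) (min_neg_le q.2) (min_le_min f.le.1 le_rfl) f.le.2)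
    (Wedge.hom (min_neg_le q.2) q.2 (min_le_left _ _) le_rfl)
  apply (cancel_epi (wedgeExtπ (gridKer V) p.2)).1
  refine ((reassoc_of% e₁) _).trans ?_
  rw [hθ, ← reassoc_of% e₃, e₂, reassoc_of% hθ]

end Grid

/-! ### Essential surjectivity. -/

section EssSurj

open scoped ZeroObject

variable {A : Type u} [Category.{v} A]

theorem gridMap_refl_right (V : ℕ ⥤ ℤ ⥤ A) {n n' : ℕ} {i : ℤ} (hn : n ≤ n') (hi : i ≤ i) :
    gridMap V hn hi = (V.map (homOfLE hn)).app i := by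
  have e : (V.obj n').map (homOfLE hi) = 𝟙 _ := (V.obj n').map_id i
  rw [gridMap, e, Category.comp_id]

theorem gridMap_refl_left (V : ℕ ⥤ ℤ ⥤ A) {n : ℕ} {i i' : ℤ} (hn : n ≤ n) (hi : i ≤ i') :
    gridMap V hn hi = (V.obj n).map (homOfLE hi) := by
  have e : V.map (homOfLE hn) = 𝟙 _ := V.map_id n
  rw [gridMap, e, NatTrans.id_app, Category.id_comp]

theorem negSucc_le_negSucc_iff {m n : ℕ} : Int.negSucc m ≤ Int.negSucc n ↔ n ≤ m := by
  omega

theorem not_ofNat_le_negSucc (m n : ℕ) : ¬ Int.ofNat m ≤ Int.negSucc n := fun h =>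
  absurd ((Int.natCast_nonneg m).trans h) (Int.negSucc_not_nonneg n).1

variable [HasZeroObject A]

/-- The values of the extension by zero of `G : ℕᵒᵖ ⥤ A`, the integer `-n - 1` taking the place of
`n`. -/
def zeroExtObj (G : ℕᵒᵖ ⥤ A) : ℤ → A
  | .ofNat _ => 0
  | .negSucc n => G.obj (op n)

theorem isZero_zeroExtObj (G : ℕᵒᵖ ⥤ A) {i : ℤ} (h : 0 ≤ i) : IsZero (zeroExtObj G i) := by
  cases i with
  | ofNat n => exact isZero_zero A
  | negSucc n => omega

variable [Preadditive A]

/-- The maps of the extension by zero. -/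
def zeroExtMap (G : ℕᵒᵖ ⥤ A) : ∀ i i' : ℤ, i ≤ i' → (zeroExtObj G i ⟶ zeroExtObj G i')
  | .negSucc _, .negSucc _, h => G.map (homOfLE (negSucc_le_negSucc_iff.1 h)).op
  | .negSucc _, .ofNat _, _ => 0
  | .ofNat _, _, _ => 0

/-- The extension by zero of a functor `ℕᵒᵖ ⥤ A` to the integers. -/
def zeroExt : (ℕᵒᵖ ⥤ A) ⥤ (ℤ ⥤ A) where
  obj G :=
    { obj := zeroExtObj G
      map := fun {i i'} f => zeroExtMap G i i' f.le
      map_id := fun i => by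
        cases i with
        | ofNat n => exact (isZero_zero A).eq_of_src _ _
        | negSucc n => exact G.map_id _
      map_comp := fun {i i' i''} f g => by
        cases i with
        | ofNat n => exact (isZero_zero A).eq_of_src _ _
        | negSucc n =>
          cases i'' with
          | ofNat m => exact (isZero_zero A).eq_of_tgt _ _
          | negSucc m =>
            cases i' with
            | ofNat k => exact absurd g.le (not_ofNat_le_negSucc k m)
            | negSucc k => exact G.map_comp _ _ }
  map {G H} f :=
    { app := fun i => match i with
        | .ofNat _ => 𝟙 _
        | .negSucc n => f.app (op n)
      naturality := fun i i' t => by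
        cases i with
        | ofNat n => exact (isZero_zero A).eq_of_src _ _
        | negSucc n =>
          cases i' with
          | ofNat m => exact (isZero_zero A).eq_of_tgt _ _
          | negSucc m => exact f.naturality _ }
  map_id G := by
    ext i
    cases i <;> rfl
  map_comp f g := by
    ext i
    cases i with
    | ofNat n => exact (isZero_zero A).eq_of_src _ _
    | negSucc n => rfl

variable [HasBinaryBiproducts A] {𝓔 : ExactStructure A}

/-- At negative integers these are the properties of `X`; elsewhere the values vanish. A square
reaching the zero region is in general not cartesian, whence the restriction `i' < 0` in
`IsGrid.isPullback`. -/
theorem isGrid_zeroExt {X : ℕ ⥤ ℕᵒᵖ ⥤ A} (hX : IsAdmBifunctor 𝓔 X) (hX' : HasCartesianSquares X) :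
    IsGrid 𝓔 (X ⋙ zeroExt) where
  admEpi n {i i'} hi := by
    rw [gridMap_refl_left]
    cases i' with
    | ofNat m => exact isAdmEpi_of_isZero 𝓔 (isZero_zero A) _
    | negSucc m =>
      cases i with
      | ofNat k => exact absurd hi (not_ofNat_le_negSucc k m)
      | negSucc k => exact hX.admEpi n (homOfLE (negSucc_le_negSucc_iff.1 hi))
  admMono {n n'} hn i := by
    rw [gridMap_refl_right]
    cases i with
    | ofNat k => exact isAdmMono_of_isZero 𝓔 (isZero_zero A) _
    | negSucc k => exact hX.admMono k (homOfLE hn)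
  isPullback {n n'} hn {i i'} hi hi' := by
    rw [gridMap_refl_left, gridMap_refl_left, gridMap_refl_right, gridMap_refl_right]
    cases i' with
    | ofNat m => exact absurd hi' (Int.natCast_nonneg m).not_gt
    | negSucc m =>
      cases i with
      | ofNat k => exact absurd hi (not_ofNat_le_negSucc k m)
      | negSucc k => exact hX' (homOfLE (negSucc_le_negSucc_iff.1 hi)) (homOfLE hn)
  isZero n {i} hi := isZero_zeroExtObj _ hi

/-- A bifunctor on `ℕᵒᵖ × ℕ` with the properties defining the admissible Kato category extends to an
admissible functor on `Wedge` with the same formal limit. -/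
theorem exists_isAdm {X : ℕ ⥤ ℕᵒᵖ ⥤ A} (hX : IsAdmBifunctor 𝓔 X) (hX' : HasCartesianSquares X) :
    ∃ W : Wedge ⥤ A, isAdm 𝓔 W ∧ Nonempty (wedgeLim.obj W ≅ (indProLim ℕ ℕ).obj X) := by
  have hV := isGrid_zeroExt hX hX'
  have := hV.hasKernel
  have := hV.hasCokernel
  refine ⟨_, hV.isAdm_wedgeExt, ?_⟩
  obtain ⟨θ, hθ⟩ := hV.exists_iso
  have hF : Monotone (fun n : ℕ => (n : ℤ)) := fun a b h => Int.ofNat_le.2 h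
  -- The pro-index `0` goes to `-1`, not to `0`, so that all pairs used lie in the quadrant covered
  -- by `IsGrid.exists_iso`.
  have hG : Monotone (fun n : ℕ => OrderDual.toDual (Int.negSucc n)) := fun a b h =>
    show Int.negSucc b ≤ Int.negSucc a from negSucc_le_negSucc_iff.2 h
  have : hF.functor.Final := by
    rw [Monotone.final_functor_iff]
    exact fun n => ⟨n.toNat, Int.self_le_toNat n⟩
  have : hG.functor.Final := by
    rw [Monotone.final_functor_iff]
    exact fun n => ⟨(-(OrderDual.ofDual n)).toNat,
      show Int.negSucc (-(OrderDual.ofDual n)).toNat ≤ OrderDual.ofDual n by omega⟩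
  obtain ⟨e⟩ := indProLim_restrict hG.functor hF.functor
    (extend.obj (wedgeExt (gridKer (X ⋙ zeroExt))))
  have hlt : ∀ n j : ℕ, min (Int.negSucc n) (j : ℤ) < 0 := fun n j => by omega
  have hle : ∀ n j : ℕ, Int.negSucc n ≤ (j : ℤ) := fun n j => by omega
  let σ : ∀ n j : ℕ, Wedge.mk (min (Int.negSucc n) (j : ℤ)) j (min_le_right _ _) ≅
      Wedge.mk (Int.negSucc n) j (hle n j) := fun n j =>
    ⟨Wedge.hom _ _ (min_le_left _ _) le_rfl,
      Wedge.hom _ _ (le_min le_rfl (hle n j)) le_rfl, Subsingleton.elim _ _, Subsingleton.elim _ _⟩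
  let c : ∀ n j : ℕ, (wedgeExt (gridKer (X ⋙ zeroExt))).obj
      (Wedge.mk (min (Int.negSucc n) (j : ℤ)) j (min_le_right _ _)) ≅ (X.obj j).obj (op n) :=
    fun n j => θ _ (hlt n j) (Int.natCast_nonneg j) ≪≫ (gridSrc (X ⋙ zeroExt)).mapIso (σ n j)
  have hc : ∀ (n n' j j' : ℕ) (hn : n' ≤ n) (hj : j ≤ j')
      (t : Wedge.mk (min (Int.negSucc n) (j : ℤ)) j (min_le_right _ _) ⟶
        Wedge.mk (min (Int.negSucc n') (j' : ℤ)) j' (min_le_right _ _)),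
      (wedgeExt (gridKer (X ⋙ zeroExt))).map t ≫ (c n' j').hom =
        (c n j).hom ≫ (X.map (homOfLE hj)).app (op n) ≫ (X.obj j').map (homOfLE hn).op := by
    intro n n' j j' hn hj t
    have e₁ := hθ _ _ t (hlt n j) (Int.natCast_nonneg j) (hlt n' j') (Int.natCast_nonneg j')
    have e₂ := wedge_comp (gridSrc (X ⋙ zeroExt)) t (σ n' j').hom (σ n j).hom
      (Wedge.hom (hle n j) (hle n' j') (negSucc_le_negSucc_iff.2 hn) (Int.ofNat_le.2 hj))
    refine (Category.assoc _ _ _).symm.trans ((congrArg (fun t => t ≫ _) e₁).trans ?_)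
    refine (Category.assoc _ _ _).trans ((congrArg (fun t => _ ≫ t) e₂).trans ?_)
    exact (Category.assoc _ _ _).symm
  refine ⟨e ≪≫ (indProLim ℕ ℕ).mapIso (NatIso.ofComponents (fun j => NatIso.ofComponents
    (fun n => c n.unop j) fun {n n'} t => ?_) fun {j j'} t => ?_)⟩
  · refine (hc n.unop n'.unop j j t.unop.le le_rfl _).trans ?_
    have h : (X.map (homOfLE (le_refl j))).app (op n.unop) = 𝟙 _ := by
      rw [show homOfLE (le_refl j) = 𝟙 j from rfl, X.map_id]
      rfl
    rw [h]
    exact congrArg (fun t => _ ≫ t) (Category.id_comp _)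
  · ext n
    refine (hc n.unop n.unop j j' le_rfl t.le _).trans ?_
    have h : (X.obj j').map (homOfLE (le_refl n.unop)).op = 𝟙 _ := (X.obj j').map_id n
    rw [h]
    exact congrArg (fun t => _ ≫ t) (Category.comp_id _)

theorem IsAdmBifunctor.restrict {I J I' J' : Type} [SmallCategory I] [SmallCategory J]
    [SmallCategory I'] [SmallCategory J'] {X : J ⥤ Iᵒᵖ ⥤ A} (hX : IsAdmBifunctor 𝓔 X)
    (G : I' ⥤ I) (F : J' ⥤ J) : IsAdmBifunctor 𝓔 (restrict G F X) where
  admEpi j _ _ f := hX.admEpi (F.obj j) (G.map f)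
  admMono i _ _ g := hX.admMono (G.obj i) (F.map g)

instance : (embedding 𝓔).EssSurj where
  mem_essImage P := by
    obtain ⟨I, J, _, _, _, _, _, _, X, hX, hX', ⟨e⟩⟩ := P.property
    obtain ⟨e'⟩ := indProLim_restrict (IsFiltered.sequentialFunctor I)
      (IsFiltered.sequentialFunctor J) X
    obtain ⟨W, hW, ⟨e''⟩⟩ := exists_isAdm (hX.restrict (IsFiltered.sequentialFunctor I)
      (IsFiltered.sequentialFunctor J)) (fun f _ _ g => hX' _ _)
    exact ⟨(Ua 𝓔).Q.obj ⟨W, hW⟩, ⟨ObjectProperty.isoMk _ (ObjectProperty.isoMk _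
      (e'' ≪≫ e'.symm ≪≫ e.symm))⟩⟩

end EssSurj

end LocCompact

end

/-- For an exact category `A`, the functor from the Beilinson category to the admissible Kato
category induced by `X ↦ "colim"_j "lim"_i X_{i,j}` is an equivalence of categories. -/
theorem mainTheorem2 {A : Type u} [Category.{v} A] [Preadditive A] [HasZeroObject A]
    [HasBinaryBiproducts A] (𝓔 : LocCompact.ExactStructure A) :
    (LocCompact.embedding 𝓔).IsEquivalence := by
  -- The fields are the instances of `Faithful`, `Full` and `EssSurj` for `embedding 𝓔`.
  exact { }
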